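/- Let $N, M \ge 1$, $a_1,\dots,a_M > 0$ and $0<\alpha_1<\dots<\alpha_M<2$. For $0<\alpha<2$ let $D_0^{\alpha}$ be the pseudo-differential operator on $\mathbb{R}^N$ with symbol $-|\xi|^{\alpha}$, and put $$b(\alpha)=\frac{\alpha\,\Gamma(\frac{\alpha}{2})\,\Gamma(\frac{N+\alpha}{2})\,\sin\frac{\alpha\pi}{2}}{2^{2-\alpha}\,\pi^{1+N/2}},\qquad \mathcal{R}(\alpha)=\sum_{0\neq k\in\mathbb{Z}^N}\frac{1}{|k|^{N+\alpha}},$$ where $|\cdot|$ is the Euclidean norm. A fundamental solution of the equation $$\frac{\partial}{\partial t}u(t,x)=\sum_{m=1}^M a_m D_0^{\alpha_m}u(t,x),\qquad t>0,\ x\in\mathbb{R}^N,\tag{1}$$ is a family $G(t,\cdot)\in L^1(\mathbb{R}^N)$, $t>0$, bounded in $L^1$ for $t$ in bounded sets, which solves (1) in the weak sense with initial value $\delta$: for every Schwartz function $\varphi$, $\frac{d}{dt}\int G(t,x)\varphi(x)\,dx=\int G(t,x)\sum_m a_m D_0^{\alpha_m}\varphi(x)\,dx$ for all $t>0$, and $\int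 G(t,x)\varphi(x)\,dx\to\varphi(0)$ as $t\to0^+$. Then: **(a)** A fundamental solution $G$ of (1) exists, it is unique (up to null sets, for every $t>0$), and for every $t>0$ the function $G(t,\cdot)$ is a probability density on $\mathbb{R}^N$. **(b)** Let $t>0$, let $h_n>0$ ($n\ge1$) with $h_n\to0$, and put $\tau_n=t/n$ and $\mu_m=\mu_m^{(n)}=2\tau_n/h_n^{\alpha_m}$. Assume that for every $n\ge1$ $$\sum_{m=1}^M a_m\, b(\alpha_m)\,\mathcal{R}(\alpha_m)\,\mu_m\le1 .$$ For every $n\ge 1$ let $\mathbf{X}_1,\mathbf{X}_2,\dots$ (depending on $n$) be independent random vectors in $\mathbb{Z}^N$, each with the transition probabilities $$p_k=P(\mathbf{X}_i=k)=\begin{cases}1-\displaystyle\sum_{j\neq0}\frac{1}{|j|^N}\sum_{m=1}^M\frac{\mu_m a_m b(\alpha_m)}{|j|^{\alpha_m}},&k=0,\\[2mm]\displaystyle\frac{1}{|k|^N}\sum_{m=1}^M\frac{\mu_m a_m b(\alpha_m)}{|k|^{\alpha_m}},&k\neq0.\end{cases}$$ Then the random vectors $\mathbf{S}_n=h_n\mathbf{X}_1+\dots+h_n\mathbf{X}_n$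 converge in law, as $n\to\infty$, to the random vector whose probability density function is the fundamental solution $G(t,\cdot)$ of (1). -/

import Mathlib

open scoped FourierTransform SchwartzMap Topology
open MeasureTheory ProbabilityTheory Filter

noncomputable section

namespace FractionalWalk

/-- The norming constant `b(α)` of the hypersingular integral
`D₀^α f (x) = b(α) ∫ (f (x + y) - 2 f x + f (x - y)) / |y| ^ (N + α) dy` in dimension `N`. -/
def normConst (N : ℕ) (α : ℝ) : ℝ :=
  α * Real.Gamma (α / 2) * Real.Gamma ((N + α) / 2) * Real.sin (α * Real.pi / 2) /
    ((2 : ℝ) ^ (2 - α) * Real.pi ^ (1 + (N : ℝ) / 2))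

/-- The lattice point of `ℤ^N` with integer coordinates `k`, as a vector of `ℝ^N` with the
Euclidean norm. -/
def latticePoint {N : ℕ} (k : Fin N → ℤ) : EuclideanSpace ℝ (Fin N) :=
  WithLp.toLp 2 (fun i => (k i : ℝ))

/-- The lattice zeta function `R(α) = ∑_{k ≠ 0} |k| ^ (-(N + α))`, the sum over `k ∈ ℤ^N`. -/
def latticeZeta (N : ℕ) (α : ℝ) : ℝ :=
  ∑' k : {k : Fin N → ℤ // k ≠ 0}, 1 / ‖latticePoint k.1‖ ^ ((N : ℝ) + α)

/-- The scaling factor `μ = 2 τ / h ^ α` for time step `τ` and mesh width `h`. -/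
def scaleFactor (τ h α : ℝ) : ℝ := 2 * τ / h ^ α

/-- `|k| ^ (-N) ∑_m μ_m a_m b(α_m) / |k| ^ α_m`, the probability of a jump by `k ≠ 0`. -/
def jumpWeight {N M : ℕ} (a α : Fin M → ℝ) (τ h : ℝ) (k : Fin N → ℤ) : ℝ :=
  1 / ‖latticePoint k‖ ^ N *
    ∑ m, scaleFactor τ h (α m) * a m * normConst N (α m) / ‖latticePoint k‖ ^ α m

/-- The transition probabilities `p_k`, `k ∈ ℤ^N`. -/
def transitionProb {N M : ℕ} (a α : Fin M → ℝ) (τ h : ℝ) (k : Fin N → ℤ) : ℝ :=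
  open Classical in
  if k = 0 then 1 - ∑' j : {j : Fin N → ℤ // j ≠ 0}, jumpWeight a α τ h j.1
  else jumpWeight a α τ h k

/-- The symbol `B(ξ) = - ∑_m a_m |ξ| ^ α_m` of the operator `∑_m a_m D₀^{α_m}`. -/
def multitermSymbol {N M : ℕ} (a α : Fin M → ℝ) (ξ : EuclideanSpace ℝ (Fin N)) : ℝ :=
  -∑ m, a m * ‖ξ‖ ^ α m

/-- The operator `∑_m a_m D₀^{α_m}`, that is, the pseudo-differential operator with symbol
`B(ξ) = - ∑_m a_m |ξ| ^ α_m`, on Schwartz functions. Mathlib's Fourier transform `𝓕` is taken with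
the character `e^{-2πi⟨x, ξ⟩}`, so that its variable `ξ` corresponds to the angular frequency
`2πξ`. -/
def multitermOp {N M : ℕ} (a α : Fin M → ℝ) (φ : 𝓢(EuclideanSpace ℝ (Fin N), ℂ)) :
    EuclideanSpace ℝ (Fin N) → ℂ :=
  𝓕⁻ (fun ξ : EuclideanSpace ℝ (Fin N) =>
    (multitermSymbol a α ((2 * Real.pi) • ξ) : ℂ) * (𝓕 φ) ξ)

/-- `u (t, x)` is a fundamental solution of the Cauchy problem for
`∂_t u = ∑_m a_m D₀^{α_m} u`, `t > 0`, `x ∈ ℝ^N`: a family of integrable functions of `x`,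
bounded in `L¹` for `t` in bounded sets, which solves the equation in the weak sense, that is, after
pairing with any test function (the operator, whose symbol is even, being moved to the test
function), and which has the initial value `δ(x)`. -/
structure IsFundamentalSolution {N M : ℕ} (a α : Fin M → ℝ)
    (u : ℝ → EuclideanSpace ℝ (Fin N) → ℝ) : Prop where
  integrable : ∀ t, 0 < t → Integrable (u t) volume
  locally_bounded : ∀ T, 0 < T → ∃ C : ℝ, ∀ t, 0 < t → t ≤ T → ∫ x, ‖u t x‖ ≤ C
  weak_eq : ∀ φ : 𝓢(EuclideanSpace ℝ (Fin N), ℂ), ∀ t, 0 < t →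
    HasDerivAt (fun s => ∫ x, (u s x : ℂ) * φ x) (∫ x, (u t x : ℂ) * multitermOp a α φ x) t
  initial : ∀ φ : 𝓢(EuclideanSpace ℝ (Fin N), ℂ),
    Tendsto (fun s => ∫ x, (u s x : ℂ) * φ x) (𝓝[>] 0) (𝓝 (φ 0))

/-- `f` is a probability density on `ℝ^N`. -/
structure IsProbDensity {N : ℕ} (f : EuclideanSpace ℝ (Fin N) → ℝ) : Prop where
  integrable : Integrable f volume
  nonneg : ∀ᵐ x, 0 ≤ f x
  integral_eq_one : ∫ x, f x = 1

/-- The scaled position `S_n = h X_1 + ⋯ + h X_n`; here the jumps are numbered from `0`. -/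
def scaledSum {N : ℕ} {Ω : Type*} (h : ℝ) (X : ℕ → Ω → Fin N → ℤ) (n : ℕ) (ω : Ω) :
    EuclideanSpace ℝ (Fin N) :=
  ∑ i ∈ Finset.range n, h • latticePoint (X i ω)

end FractionalWalk

end

/-! The Fourier transform diagonalises (1): the transform of the solution at time `t` must be `exp
(t B(ξ))` with `B(ξ) = -∑ a_m |ξ| ^ α_m`. Everything else rests on the identity `|ξ| ^ β = 2 b(β) ∫
(1 - cos ⟪y, ξ⟫) / |y| ^ (N + β) dy` for `0 < β < 2` (`normConst_mul_integral_levyKernel`), which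
explains the constant `b`.

Existence: `G(t, ·)` is the cosine transform of `exp (t B)`. For its sign, truncate the Lévy density
to an integrable weight `w`. Then `exp (-∫ (1 - cos) w)` is a positive constant times `exp` of the
cosine transform of `w`, a limit of powers `(1 + ŵ / n) ^ n`, and nonnegativity of
Gaussian-regularised cosine transforms survives each operation (`IsPosType`). Nonnegativity and
Fatou's lemma give integrability, and Fourier inversion at `0` gives mass `1`.

Uniqueness: `B` is not smooth at the origin, so solutions are compared only against frequency
functions `g` supported away from `0`, for which every `B ^ k g` is a test function. The pairings `F
k` of the difference with `B ^ k g` satisfy `F k' = F (k + 1)`, tend to `0` at time `0` and are at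
most `C K ^ k`; iterated integration makes them vanish (`eq_zero_of_hasDerivAt_succ`).

Convergence in law: by symmetry a jump has characteristic function `1 - ∑ p_k (1 - cos ⟪h k, ξ⟫)`.
The scaling `μ_m = 2 τ / h ^ α_m` makes this sum `τ` times a Riemann sum of Lévy kernels with mesh
`h` (`tendsto_riemannSum_levyKernel`). With `τ = t / n`, the `n`-th power tends to `exp (t B(ξ))`,
and Lévy's continuity theorem concludes. -/

noncomputable section

namespace FractionalWalk

/-! ### The Lévy–Khintchine formula for `|ξ| ^ β`. -/

/-- The integrand `(1 - cos ⟪y, ξ⟫) / |y| ^ (N + β)` of the Lévy–Khintchine representation of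
`|ξ| ^ β`. -/
def levyKernel {N : ℕ} (β : ℝ) (ξ y : EuclideanSpace ℝ (Fin N)) : ℝ :=
  (1 - Real.cos (inner ℝ y ξ)) / ‖y‖ ^ ((N : ℝ) + β)

/-- In polar coordinates the integrand is `r ^ (1 - β)` near `0` and `r ^ (-1 - β)` at infinity,
which is where `β < 2` and `0 < β` enter. Multiples of this function dominate the Lévy kernel, its
lattice discretisations and its truncations. -/
lemma integrable_min_one_sq_div_rpow {N : ℕ} [NeZero N] {β : ℝ} (h0 : 0 < β) (h2 : β < 2) :
    Integrable (fun y : EuclideanSpace ℝ (Fin N) => min 1 (‖y‖ ^ 2) / ‖y‖ ^ ((N : ℝ) + β)) := by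
  rw [integrable_fun_norm_addHaar volume
    (f := fun r : ℝ => min 1 (r ^ 2) / r ^ ((N : ℝ) + β)), finrank_euclideanSpace_fin]
  have hN : 1 ≤ N := NeZero.one_le
  have hpow : ∀ r : ℝ, 0 < r → r ^ (N - 1) = r ^ ((N : ℝ) - 1) := by
    intro r hr
    rw [← Real.rpow_natCast, Nat.cast_sub hN, Nat.cast_one]
  rw [← Set.Ioc_union_Ioi_eq_Ioi (zero_le_one (α := ℝ))]
  refine IntegrableOn.union ?_ ?_
  · have h := (intervalIntegral.integrableOn_Ioo_rpow_iff (s := 1 - β) one_pos).2 (by linarith)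
    rw [← integrableOn_Ioc_iff_integrableOn_Ioo] at h
    refine h.congr_fun ?_ measurableSet_Ioc
    rintro r ⟨hr, hr1⟩
    have h1 : min 1 (r ^ 2) = r ^ (2 : ℝ) := by
      rw [Real.rpow_two]
      exact min_eq_right (by nlinarith)
    simp only [smul_eq_mul]
    rw [hpow r hr, h1, ← Real.rpow_sub hr, ← Real.rpow_add hr]
    congr 1
    ring
  · have h := integrableOn_Ioi_rpow_of_lt (a := -1 - β) (by linarith) one_pos
    refine h.congr_fun ?_ measurableSet_Ioi
    intro r hr
    have hr1 : 1 < r := hr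
    have hr0 : 0 < r := by linarith
    have h1 : min 1 (r ^ 2) = 1 := min_eq_left (by nlinarith)
    simp only [smul_eq_mul]
    rw [hpow r hr0, h1, ← Real.rpow_zero r, ← Real.rpow_sub hr0, ← Real.rpow_add hr0]
    congr 1
    ring

lemma one_sub_cos_le_min (x : ℝ) : 1 - Real.cos x ≤ 2 * min 1 (x ^ 2) := by
  rw [mul_min_of_nonneg _ _ zero_le_two]
  refine le_min ?_ ?_
  · linarith [Real.neg_one_le_cos x]
  · nlinarith [Real.one_sub_sq_div_two_le_cos (x := x), sq_nonneg x]

lemma levyKernel_nonneg {N : ℕ} (β : ℝ) (ξ y : EuclideanSpace ℝ (Fin N)) :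
    0 ≤ levyKernel β ξ y :=
  div_nonneg (by linarith [Real.cos_le_one (inner ℝ y ξ)]) (by positivity)

lemma one_sub_cos_inner_le {N : ℕ} (ξ y : EuclideanSpace ℝ (Fin N)) :
    1 - Real.cos (inner ℝ y ξ) ≤ 2 * (1 + ‖ξ‖ ^ 2) * min 1 (‖y‖ ^ 2) := by
  have hi : (inner ℝ y ξ) ^ 2 ≤ ‖y‖ ^ 2 * ‖ξ‖ ^ 2 := by
    rw [← mul_pow, ← sq_abs]
    gcongr
    exact abs_real_inner_le_norm y ξ
  have h := one_sub_cos_le_min (inner ℝ y ξ)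
  refine h.trans ?_
  rw [mul_assoc]
  gcongr
  rw [mul_min_of_nonneg _ _ (by positivity)]
  refine min_le_min ?_ ?_
  · nlinarith [sq_nonneg ‖ξ‖]
  · nlinarith [sq_nonneg ‖y‖]

lemma levyKernel_le {N : ℕ} (β : ℝ) (ξ y : EuclideanSpace ℝ (Fin N)) :
    levyKernel β ξ y ≤ 2 * (1 + ‖ξ‖ ^ 2) * (min 1 (‖y‖ ^ 2) / ‖y‖ ^ ((N : ℝ) + β)) := by
  rw [levyKernel, ← mul_div_assoc]
  gcongr
  exact one_sub_cos_inner_le ξ y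

@[fun_prop]
lemma measurable_levyKernel {N : ℕ} (β : ℝ) (ξ : EuclideanSpace ℝ (Fin N)) :
    Measurable (levyKernel β ξ) := by
  unfold levyKernel
  fun_prop

lemma integrable_levyKernel {N : ℕ} [NeZero N] {β : ℝ} (h0 : 0 < β) (h2 : β < 2)
    (ξ : EuclideanSpace ℝ (Fin N)) : Integrable (levyKernel β ξ) := by
  refine ((integrable_min_one_sq_div_rpow h0 h2).const_mul (2 * (1 + ‖ξ‖ ^ 2))).mono'
    (by fun_prop) (ae_of_all _ fun y => ?_)
  rw [Real.norm_of_nonneg (levyKernel_nonneg β ξ y)]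
  exact levyKernel_le β ξ y

lemma one_sub_exp_neg_le_min (x : ℝ) : 1 - Real.exp (-x) ≤ min 1 x :=
  le_min (by linarith [Real.exp_pos (-x)]) (by linarith [Real.add_one_le_exp (-x)])

lemma one_sub_exp_neg_nonneg {x : ℝ} (hx : 0 ≤ x) : 0 ≤ 1 - Real.exp (-x) := by
  linarith [Real.exp_le_one_iff.2 (neg_nonpos.2 hx)]

lemma integrableOn_rpow_mul_one_sub_exp {b c : ℝ} (h0 : 0 < b) (h1 : b < 1) (hc : 0 ≤ c) :
    IntegrableOn (fun v : ℝ => v ^ (-b - 1) * (1 - Real.exp (-(c * v)))) (Set.Ioi 0) := by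
  rw [← Set.Ioc_union_Ioi_eq_Ioi (zero_le_one (α := ℝ))]
  have hm : ∀ s : Set ℝ, AEStronglyMeasurable
      (fun v : ℝ => v ^ (-b - 1) * (1 - Real.exp (-(c * v)))) (volume.restrict s) :=
    fun s => by fun_prop
  refine IntegrableOn.union ?_ ?_
  · have h := (intervalIntegral.integrableOn_Ioo_rpow_iff (s := -b) one_pos).2 (by linarith)
    rw [← integrableOn_Ioc_iff_integrableOn_Ioo] at h
    refine Integrable.mono' (h.const_mul c) (hm _) ?_
    refine ae_restrict_of_forall_mem measurableSet_Ioc ?_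
    rintro v ⟨hv, -⟩
    rw [Real.norm_of_nonneg (mul_nonneg (by positivity) (one_sub_exp_neg_nonneg (by positivity)))]
    calc v ^ (-b - 1) * (1 - Real.exp (-(c * v)))
        ≤ v ^ (-b - 1) * (c * v) := by
          gcongr
          exact (one_sub_exp_neg_le_min _).trans (min_le_right _ _)
      _ = c * v ^ (-b) := by
          rw [Real.rpow_sub_one hv.ne']
          field_simp
  · have h := integrableOn_Ioi_rpow_of_lt (a := -b - 1) (by linarith) one_pos
    refine Integrable.mono' h (hm _) ?_
    refine ae_restrict_of_forall_mem measurableSet_Ioi ?_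
    intro v hv
    have hv1 : 1 < v := hv
    have hv0 : 0 < v := by linarith
    rw [Real.norm_of_nonneg (mul_nonneg (by positivity) (one_sub_exp_neg_nonneg (by positivity)))]
    refine mul_le_of_le_one_right (by positivity) ?_
    exact (one_sub_exp_neg_le_min _).trans (min_le_left _ _)

/-- Integration by parts differentiates `1 - exp (-c v)` and leaves a Gamma integral. The boundary
terms vanish because `1 - exp (-c v) ≤ min 1 (c v)`: the bound `c v` serves at `0` (as `b < 1`), the
bound `1` at infinity (as `0 < b`). -/
lemma integral_rpow_mul_one_sub_exp {b c : ℝ} (h0 : 0 < b) (h1 : b < 1) (hc : 0 < c) :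
    ∫ v in Set.Ioi (0 : ℝ), v ^ (-b - 1) * (1 - Real.exp (-(c * v))) =
      c ^ b * Real.Gamma (1 - b) / b := by
  have hG : IntegrableOn (fun v : ℝ => v ^ (-b) * Real.exp (-c * v ^ (1 : ℝ))) (Set.Ioi 0) :=
    integrableOn_rpow_mul_exp_neg_mul_rpow (by linarith) one_pos hc
  have hparts := integral_Ioi_mul_deriv_eq_deriv_mul (A := ℝ) (a := 0) (a' := 0) (b' := 0)
    (u := fun v => 1 - Real.exp (-(c * v))) (u' := fun v => c * Real.exp (-(c * v)))
    (v := fun v => v ^ (-b) / (-b)) (v' := fun v => v ^ (-b - 1))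
    (fun x _ => by
      have := (((hasDerivAt_id x).const_mul c).neg.exp).const_sub 1
      simpa [mul_comm] using this)
    (fun x hx => by
      have hx0 : 0 < x := hx
      have := (Real.hasDerivAt_rpow_const (x := x) (p := -b) (Or.inl hx0.ne')).div_const (-b)
      convert this using 1
      field_simp)
    (by
      refine (integrableOn_rpow_mul_one_sub_exp h0 h1 hc.le).congr_fun ?_ measurableSet_Ioi
      intro v _
      simp only [Pi.mul_apply]
      ring)
    (by
      have hG' : IntegrableOn (fun v : ℝ => -(c / b) * (v ^ (-b) * Real.exp (-c * v ^ (1 : ℝ))))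
        (Set.Ioi 0) := hG.const_mul _
      refine hG'.congr_fun ?_ measurableSet_Ioi
      intro v _
      simp only [Pi.mul_apply, Real.rpow_one]
      field_simp)
    (by
      have hlim : Tendsto (fun v : ℝ => c / b * v ^ (1 - b)) (𝓝[>] 0) (𝓝 0) := by
        have : Tendsto (fun v : ℝ => v ^ (1 - b)) (𝓝[>] 0) (𝓝 ((0 : ℝ) ^ (1 - b))) :=
          ((Real.continuousAt_rpow_const 0 (1 - b) (Or.inr (by linarith))).tendsto).mono_left
            nhdsWithin_le_nhds
        rw [Real.zero_rpow (by linarith)] at this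
        simpa using this.const_mul (c / b)
      refine squeeze_zero_norm' ?_ hlim
      filter_upwards [self_mem_nhdsWithin] with v hv
      have hv0 : 0 < v := hv
      have hE := one_sub_exp_neg_nonneg (x := c * v) (by positivity)
      rw [Pi.mul_apply, norm_mul, Real.norm_of_nonneg hE, norm_div, norm_neg,
        Real.norm_of_nonneg h0.le, Real.norm_of_nonneg (by positivity)]
      calc (1 - Real.exp (-(c * v))) * (v ^ (-b) / b) ≤ (c * v) * (v ^ (-b) / b) := by
            gcongr
            exact (one_sub_exp_neg_le_min _).trans (min_le_right _ _)
        _ = c / b * v ^ (1 - b) := by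
            rw [sub_eq_add_neg, Real.rpow_add hv0, Real.rpow_one]
            ring)
    (by
      have hlim : Tendsto (fun v : ℝ => v ^ (-b) / b) atTop (𝓝 0) := by
        simpa using (tendsto_rpow_neg_atTop h0).div_const b
      refine squeeze_zero_norm' ?_ hlim
      filter_upwards [eventually_gt_atTop 0] with v hv0
      have hE := one_sub_exp_neg_nonneg (x := c * v) (by positivity)
      rw [Pi.mul_apply, norm_mul, Real.norm_of_nonneg hE, norm_div, norm_neg,
        Real.norm_of_nonneg h0.le, Real.norm_of_nonneg (by positivity)]
      refine mul_le_of_le_one_left (by positivity) ?_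
      exact (one_sub_exp_neg_le_min _).trans (min_le_left _ _))
  have hΓ := Real.integral_rpow_mul_exp_neg_mul_Ioi (a := 1 - b) (r := c) (by linarith) hc
  calc ∫ v in Set.Ioi (0 : ℝ), v ^ (-b - 1) * (1 - Real.exp (-(c * v)))
      = ∫ v in Set.Ioi (0 : ℝ), (1 - Real.exp (-(c * v))) * v ^ (-b - 1) := by
        simp_rw [mul_comm]
    _ = c / b * ∫ v in Set.Ioi (0 : ℝ), v ^ (1 - b - 1) * Real.exp (-(c * v)) := by
        rw [hparts, ← integral_const_mul, sub_zero, zero_sub, ← integral_neg]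
        refine integral_congr_ae (ae_of_all _ fun v => ?_)
        have : 1 - b - 1 = -b := by ring
        simp only [this]
        field_simp
    _ = c ^ b * Real.Gamma (1 - b) / b := by
        rw [hΓ, one_div, Real.inv_rpow hc.le, Real.rpow_sub hc, Real.rpow_one]
        field_simp

lemma integral_rpow_mul_one_sub_exp_div {b c : ℝ} (h0 : 0 < b) (h1 : b < 1) (hc : 0 < c) :
    ∫ u in Set.Ioi (0 : ℝ), u ^ (b - 1) * (1 - Real.exp (-(c / u))) =
      c ^ b * Real.Gamma (1 - b) / b := by
  rw [← integral_rpow_mul_one_sub_exp h0 h1 hc,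
    ← integral_comp_rpow_Ioi (fun v : ℝ => v ^ (-b - 1) * (1 - Real.exp (-(c * v))))
      (p := -1) (by norm_num)]
  refine setIntegral_congr_fun measurableSet_Ioi fun u hu => ?_
  have hu0 : 0 < u := hu
  simp only [smul_eq_mul, abs_neg, abs_one, one_mul]
  rw [← mul_assoc, ← Real.rpow_mul hu0.le, ← Real.rpow_add hu0, Real.rpow_neg_one, div_eq_mul_inv]
  congr 2
  ring

lemma integrable_exp_neg_mul_sq_norm {N : ℕ} {b : ℝ} (hb : 0 < b) :
    Integrable (fun y : EuclideanSpace ℝ (Fin N) => Real.exp (-b * ‖y‖ ^ 2)) := by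
  -- A non-integrable function has integral `0` by convention, whereas the Gaussian formula gives a
  -- positive value.
  by_contra h
  have h1 := GaussianFourier.integral_rexp_neg_mul_sq_norm (V := EuclideanSpace ℝ (Fin N)) hb
  rw [integral_undef h] at h1
  have : 0 < (Real.pi / b) ^ (Module.finrank ℝ (EuclideanSpace ℝ (Fin N)) / 2 : ℝ) := by positivity
  exact this.ne h1

lemma integrable_cos_inner_mul {N : ℕ} {f : EuclideanSpace ℝ (Fin N) → ℝ} (hf : Integrable f)
    (ξ : EuclideanSpace ℝ (Fin N)) : Integrable (fun y => Real.cos (inner ℝ y ξ) * f y) :=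
  hf.bdd_mul (c := 1) (by fun_prop) (ae_of_all _ fun y => Real.abs_cos_le_one _)

lemma integral_cos_inner_mul_exp {N : ℕ} {b : ℝ} (hb : 0 < b) (ξ : EuclideanSpace ℝ (Fin N)) :
    ∫ y : EuclideanSpace ℝ (Fin N), Real.cos (inner ℝ y ξ) * Real.exp (-b * ‖y‖ ^ 2) =
      (Real.pi / b) ^ ((N : ℝ) / 2) * Real.exp (-‖ξ‖ ^ 2 / (4 * b)) := by
  have h := GaussianFourier.integral_cexp_neg_mul_sq_norm_add (b := (b : ℂ)) (by simpa using hb)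
    Complex.I ξ
  have hint : Integrable (fun v : EuclideanSpace ℝ (Fin N) =>
      Complex.exp (-(b : ℂ) * (‖v‖ : ℂ) ^ 2 + Complex.I * (inner ℝ ξ v : ℝ))) := by
    refine (integrable_exp_neg_mul_sq_norm (N := N) hb).mono' (by fun_prop)
      (ae_of_all _ fun v => ?_)
    rw [Complex.norm_exp]
    simp [← Complex.ofReal_pow]
  have h' := congrArg Complex.re h
  rw [← RCLike.re_eq_complex_re, ← integral_re hint] at h'
  have hR : ((Real.pi / b : ℂ) ^ ((Module.finrank ℝ (EuclideanSpace ℝ (Fin N)) : ℂ) / 2) *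
      Complex.exp (Complex.I ^ 2 * (‖ξ‖ : ℂ) ^ 2 / (4 * b))) =
      (((Real.pi / b) ^ ((N : ℝ) / 2) * Real.exp (-‖ξ‖ ^ 2 / (4 * b)) : ℝ) : ℂ) := by
    rw [finrank_euclideanSpace_fin, Complex.ofReal_mul, Complex.ofReal_cpow (by positivity)]
    push_cast
    rw [Complex.I_sq]
    congr 2
    ring
  rw [hR] at h'
  simp only [RCLike.re_eq_complex_re, Complex.ofReal_re] at h'
  rw [← h']
  refine integral_congr_ae (ae_of_all _ fun v => ?_)
  simp only [Complex.exp_re, real_inner_comm]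
  simp [← Complex.ofReal_pow, mul_comm]

lemma integral_one_sub_cos_mul_exp {N : ℕ} {b : ℝ} (hb : 0 < b) (ξ : EuclideanSpace ℝ (Fin N)) :
    ∫ y : EuclideanSpace ℝ (Fin N), (1 - Real.cos (inner ℝ y ξ)) * Real.exp (-b * ‖y‖ ^ 2) =
      (Real.pi / b) ^ ((N : ℝ) / 2) * (1 - Real.exp (-‖ξ‖ ^ 2 / (4 * b))) := by
  have hi := integrable_exp_neg_mul_sq_norm (N := N) hb
  simp_rw [sub_mul, one_mul]
  rw [integral_sub hi (integrable_cos_inner_mul hi ξ), integral_cos_inner_mul_exp hb,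
    GaussianFourier.integral_rexp_neg_mul_sq_norm hb, finrank_euclideanSpace_fin]
  ring

/-- The integrand of the subordination formula for `levyKernel`. -/
def subordinateKernel {N : ℕ} (β : ℝ) (ξ : EuclideanSpace ℝ (Fin N))
    (y : EuclideanSpace ℝ (Fin N)) (u : ℝ) : ℝ :=
  (1 - Real.cos (inner ℝ y ξ)) * (u ^ (((N : ℝ) + β) / 2 - 1) * Real.exp (-(‖y‖ ^ 2 * u)))

/-- The power `‖y‖ ^ (-(N + β))` is a Gamma integral of Gaussians in `y`; at `y = 0` both sides
vanish through the cosine factor. -/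
lemma integral_subordinateKernel_right {N : ℕ} {β : ℝ} (h0 : 0 < β)
    (ξ y : EuclideanSpace ℝ (Fin N)) :
    ∫ u in Set.Ioi 0, subordinateKernel β ξ y u =
      Real.Gamma (((N : ℝ) + β) / 2) * levyKernel β ξ y := by
  unfold subordinateKernel levyKernel
  rcases eq_or_ne y 0 with rfl | hy
  · simp
  have hy' : 0 < ‖y‖ := norm_pos_iff.2 hy
  rw [integral_const_mul, Real.integral_rpow_mul_exp_neg_mul_Ioi (by positivity) (by positivity),
    one_div, Real.inv_rpow (by positivity), ← Real.rpow_natCast, ← Real.rpow_mul hy'.le]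
  have : ((2 : ℕ) : ℝ) * (((N : ℝ) + β) / 2) = N + β := by push_cast; ring
  rw [this]
  field_simp

lemma integrable_subordinateKernel {N : ℕ} [NeZero N] {β : ℝ} (h0 : 0 < β) (h2 : β < 2)
    (ξ : EuclideanSpace ℝ (Fin N)) :
    Integrable (Function.uncurry (subordinateKernel β ξ))
      (volume.prod (volume.restrict (Set.Ioi 0))) := by
  have hm : Measurable (Function.uncurry (subordinateKernel β ξ)) := by
    unfold subordinateKernel Function.uncurry
    fun_prop
  rw [integrable_prod_iff hm.aestronglyMeasurable]
  constructor
  · refine ae_of_all _ fun y => ?_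
    rcases eq_or_ne y 0 with rfl | hy
    · simp [Function.uncurry, subordinateKernel]
    have hy' : 0 < ‖y‖ := norm_pos_iff.2 hy
    have h := integrableOn_rpow_mul_exp_neg_mul_rpow (s := ((N : ℝ) + β) / 2 - 1) (p := 1)
      (b := ‖y‖ ^ 2) (by have : (0 : ℝ) < (N : ℝ) + β := by positivity
                         linarith) one_pos (by positivity)
    simp only [Real.rpow_one, neg_mul] at h
    have h' : IntegrableOn (fun u : ℝ => (1 - Real.cos (inner ℝ y ξ)) *
        (u ^ (((N : ℝ) + β) / 2 - 1) * Real.exp (-(‖y‖ ^ 2 * u)))) (Set.Ioi 0) := h.const_mul _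
    exact h'
  · refine ((integrable_levyKernel h0 h2 ξ).const_mul (Real.Gamma (((N : ℝ) + β) / 2))).congr
      (ae_of_all _ fun y => ?_)
    simp only
    rw [← integral_subordinateKernel_right h0]
    refine setIntegral_congr_fun measurableSet_Ioi fun u hu => ?_
    have hu0 : 0 < u := hu
    refine (Real.norm_of_nonneg ?_).symm
    exact mul_nonneg (by linarith [Real.cos_le_one (inner ℝ y ξ)]) (by positivity)

lemma integral_subordinateKernel_left {N : ℕ} {β : ℝ}
    (ξ : EuclideanSpace ℝ (Fin N)) {u : ℝ} (hu : 0 < u) :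
    ∫ y, subordinateKernel β ξ y u =
      Real.pi ^ ((N : ℝ) / 2) * (u ^ (β / 2 - 1) * (1 - Real.exp (-(‖ξ‖ ^ 2 / 4 / u)))) := by
  have h : ∀ y : EuclideanSpace ℝ (Fin N), subordinateKernel β ξ y u =
      u ^ (((N : ℝ) + β) / 2 - 1) *
        ((1 - Real.cos (inner ℝ y ξ)) * Real.exp (-u * ‖y‖ ^ 2)) := by
    intro y
    rw [subordinateKernel, neg_mul, mul_comm u]
    ring
  simp_rw [h]
  rw [integral_const_mul, integral_one_sub_cos_mul_exp hu,
    Real.div_rpow Real.pi_pos.le hu.le]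
  -- The factor `u ^ (N / 2)` cancels the normalisation `(π / u) ^ (N / 2)` of the Gaussian
  -- integral, so the remaining `u`-integral no longer depends on the dimension.
  have h1 : u ^ (((N : ℝ) + β) / 2 - 1) = u ^ ((N : ℝ) / 2) * u ^ (β / 2 - 1) := by
    rw [← Real.rpow_add hu]
    congr 1
    ring
  have h2 : -‖ξ‖ ^ 2 / (4 * u) = -(‖ξ‖ ^ 2 / 4 / u) := by field_simp
  rw [h1, h2]
  have : u ^ ((N : ℝ) / 2) ≠ 0 := by positivity
  field_simp

/-- The Lévy–Khintchine representation of `|ξ| ^ β`. -/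
theorem normConst_mul_integral_levyKernel {N : ℕ} [NeZero N] {β : ℝ} (h0 : 0 < β) (h2 : β < 2)
    (ξ : EuclideanSpace ℝ (Fin N)) :
    2 * normConst N β * ∫ y, levyKernel β ξ y = ‖ξ‖ ^ β := by
  rcases eq_or_ne ξ 0 with rfl | hξ
  · simp [levyKernel, Real.zero_rpow h0.ne']
  have hξ' : 0 < ‖ξ‖ := norm_pos_iff.2 hξ
  have hΓ : 0 < Real.Gamma (((N : ℝ) + β) / 2) := Real.Gamma_pos_of_pos (by positivity)
  have hΓ2 : 0 < Real.Gamma (β / 2) := Real.Gamma_pos_of_pos (by positivity)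
  have hsin : 0 < Real.sin (β * Real.pi / 2) :=
    Real.sin_pos_of_pos_of_lt_pi (by positivity) (by nlinarith [Real.pi_pos])
  -- The `u`-integral taken first gives `Γ((N + β) / 2)` times the wanted integral; the `y`-integral
  -- taken first gives an explicit value.
  have hswap := integral_integral_swap (integrable_subordinateKernel h0 h2 ξ)
  simp_rw [integral_subordinateKernel_right h0] at hswap
  rw [integral_const_mul, setIntegral_congr_fun measurableSet_Ioi
    (fun u hu => integral_subordinateKernel_left ξ hu), integral_const_mul,
    integral_rpow_mul_one_sub_exp_div (by positivity) (by linarith) (by positivity)] at hswap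
  -- Euler's reflection formula turns `Γ(1 - β / 2)` into the sine and `Γ(β / 2)` that appear in
  -- `normConst`.
  have hrefl := Real.Gamma_mul_Gamma_one_sub (β / 2)
  have hrefl' : Real.Gamma (1 - β / 2) =
      Real.pi / (Real.sin (β * Real.pi / 2) * Real.Gamma (β / 2)) := by
    rw [eq_div_iff (by positivity), show β * Real.pi / 2 = Real.pi * (β / 2) by ring]
    rw [eq_div_iff (by rw [show Real.pi * (β / 2) = β * Real.pi / 2 by ring]; positivity)] at hrefl
    linarith
  have hc : (‖ξ‖ ^ 2 / 4) ^ (β / 2) = ‖ξ‖ ^ β / 2 ^ β := by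
    rw [show ‖ξ‖ ^ 2 / 4 = (‖ξ‖ / 2) ^ (2 : ℝ) by rw [Real.rpow_two]; ring,
      ← Real.rpow_mul (by positivity), Real.div_rpow hξ'.le zero_le_two]
    congr 2 <;> ring
  rw [hc, hrefl'] at hswap
  have hI : ∫ y, levyKernel β ξ y = (Real.pi ^ ((N : ℝ) / 2) * (‖ξ‖ ^ β / 2 ^ β *
      (Real.pi / (Real.sin (β * Real.pi / 2) * Real.Gamma (β / 2))) / (β / 2))) /
      Real.Gamma (((N : ℝ) + β) / 2) := by
    rw [eq_div_iff hΓ.ne', ← hswap]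
    ring
  have hp1 : (2 : ℝ) ^ (2 - β) = 4 / 2 ^ β := by
    rw [Real.rpow_sub two_pos, Real.rpow_two]
    norm_num
  have hp2 : Real.pi ^ (1 + (N : ℝ) / 2) = Real.pi * Real.pi ^ ((N : ℝ) / 2) := by
    rw [Real.rpow_add Real.pi_pos, Real.rpow_one]
  rw [hI, normConst, hp1, hp2]
  field_simp
  norm_num

lemma normConst_pos {N : ℕ} {β : ℝ} (h0 : 0 < β) (h2 : β < 2) : 0 < normConst N β := by
  have hΓ : 0 < Real.Gamma (((N : ℝ) + β) / 2) := Real.Gamma_pos_of_pos (by positivity)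
  have hΓ2 : 0 < Real.Gamma (β / 2) := Real.Gamma_pos_of_pos (by positivity)
  have hsin : 0 < Real.sin (β * Real.pi / 2) :=
    Real.sin_pos_of_pos_of_lt_pi (by positivity) (by nlinarith [Real.pi_pos])
  unfold normConst
  positivity

/-! ### Lattice cells and Riemann sums of the Lévy kernel. -/

/-- The index of the cell of side `h`, centred at a point of the lattice `h ℤ^N`, that contains
`y`. -/
def cellIndex {N : ℕ} (h : ℝ) (y : EuclideanSpace ℝ (Fin N)) : Fin N → ℤ :=
  fun i => ⌊y i / h + 1 / 2⌋

@[fun_prop]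
lemma measurable_cellIndex {N : ℕ} (h : ℝ) : Measurable (cellIndex (N := N) h) := by
  refine measurable_pi_lambda _ fun i => ?_
  exact Int.measurable_floor.comp (by fun_prop)

lemma cellIndex_eq_iff {N : ℕ} {h : ℝ} (hh : 0 < h) (y : EuclideanSpace ℝ (Fin N))
    (k : Fin N → ℤ) :
    cellIndex h y = k ↔ ∀ i, y i ∈ Set.Ico (h * k i - h / 2) (h * k i + h / 2) := by
  rw [funext_iff]
  refine forall_congr' fun i => ?_
  rw [cellIndex, Int.floor_eq_iff, Set.mem_Ico]
  have e : y i = h * (y i / h) := by field_simp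
  constructor
  · rintro ⟨h1, h2⟩
    constructor <;> rw [e] <;> nlinarith
  · rintro ⟨h1, h2⟩
    rw [e] at h1 h2
    constructor
    · by_contra! hc
      nlinarith
    · by_contra! hc
      nlinarith

lemma volume_cellIndex_preimage {N : ℕ} {h : ℝ} (hh : 0 < h) (k : Fin N → ℤ) :
    volume (cellIndex (N := N) h ⁻¹' {k}) = ENNReal.ofReal (h ^ N) := by
  have hset : cellIndex (N := N) h ⁻¹' {k} = (MeasurableEquiv.toLp 2 (Fin N → ℝ)).symm ⁻¹'
      (Set.univ.pi fun i => Set.Ico (h * k i - h / 2) (h * k i + h / 2)) := by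
    ext y
    simp only [Set.mem_preimage, Set.mem_singleton_iff, cellIndex_eq_iff hh, Set.mem_pi,
      Set.mem_univ, true_imp_iff]
    rfl
  rw [hset, (EuclideanSpace.volume_preserving_symm_measurableEquiv_toLp (Fin N)).measure_preimage
    (MeasurableSet.univ_pi fun i => measurableSet_Ico).nullMeasurableSet, Real.volume_pi_Ico]
  have : ∀ i, h * (k i : ℝ) + h / 2 - (h * k i - h / 2) = h := fun i => by ring
  simp_rw [this]
  rw [Finset.prod_const, Finset.card_univ, Fintype.card_fin, ENNReal.ofReal_pow hh.le]

/-- Lattice sums thereby become integrals of functions constant on cells, so both summability and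
the limit of the Riemann sums reduce to domination on `ℝ^N`. -/
lemma map_cellIndex {N : ℕ} {h : ℝ} (hh : 0 < h) :
    (volume : Measure (EuclideanSpace ℝ (Fin N))).map (cellIndex h) =
      ENNReal.ofReal (h ^ N) • Measure.count := by
  refine Measure.ext_of_singleton fun k => ?_
  rw [Measure.map_apply (measurable_cellIndex h) (measurableSet_singleton k),
    volume_cellIndex_preimage hh]
  simp

lemma integrable_comp_cellIndex_iff {N : ℕ} {h : ℝ} (hh : 0 < h) (F : (Fin N → ℤ) → ℝ) :
    Integrable (fun y : EuclideanSpace ℝ (Fin N) => F (cellIndex h y)) ↔ Summable F := by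
  have h1 : AEStronglyMeasurable F
      ((volume : Measure (EuclideanSpace ℝ (Fin N))).map (cellIndex h)) :=
    (measurable_of_countable F).aestronglyMeasurable
  have h2 := integrable_map_measure h1 (measurable_cellIndex (N := N) h).aemeasurable
  refine h2.symm.trans ?_
  rw [map_cellIndex hh, integrable_smul_measure (by simp; positivity) (by simp),
    integrable_count_iff]
  exact summable_norm_iff

lemma integral_comp_cellIndex {N : ℕ} {h : ℝ} (hh : 0 < h) (F : (Fin N → ℤ) → ℝ) :
    ∫ y : EuclideanSpace ℝ (Fin N), F (cellIndex h y) = h ^ N * ∑' k, F k := by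
  by_cases hF : Summable F
  · have h1 : AEStronglyMeasurable F
        ((volume : Measure (EuclideanSpace ℝ (Fin N))).map (cellIndex h)) :=
      (measurable_of_countable F).aestronglyMeasurable
    refine (integral_map (measurable_cellIndex (N := N) h).aemeasurable h1).symm.trans ?_
    rw [map_cellIndex hh, integral_smul_measure, ENNReal.toReal_ofReal (by positivity),
      integral_countable (integrable_count_iff.2 hF.norm)]
    simp [measureReal_def]
  · rw [integral_undef (fun hi => hF ((integrable_comp_cellIndex_iff hh F).1 hi)),
      tsum_eq_zero_of_not_summable hF, mul_zero]

@[simp]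
lemma latticePoint_apply {N : ℕ} (k : Fin N → ℤ) (i : Fin N) : latticePoint k i = k i := rfl

@[simp]
lemma latticePoint_zero {N : ℕ} : latticePoint (0 : Fin N → ℤ) = 0 := by
  ext i
  simp

lemma latticePoint_neg {N : ℕ} (k : Fin N → ℤ) : latticePoint (-k) = -latticePoint k := by
  ext i
  simp

lemma one_le_norm_latticePoint {N : ℕ} {k : Fin N → ℤ} (hk : k ≠ 0) : 1 ≤ ‖latticePoint k‖ := by
  obtain ⟨i, hi⟩ := Function.ne_iff.1 hk
  refine le_trans ?_ (PiLp.norm_apply_le (latticePoint k) i)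
  rw [latticePoint_apply, Real.norm_eq_abs, ← Int.cast_abs]
  exact_mod_cast Int.one_le_abs hi

lemma latticePoint_ne_zero {N : ℕ} {k : Fin N → ℤ} (hk : k ≠ 0) : latticePoint k ≠ 0 :=
  norm_pos_iff.1 (zero_lt_one.trans_le (one_le_norm_latticePoint hk))

lemma norm_le_of_forall_abs_le {N : ℕ} {x y : EuclideanSpace ℝ (Fin N)} {c : ℝ} (hc : 0 ≤ c)
    (h : ∀ i, |x i| ≤ c * |y i|) : ‖x‖ ≤ c * ‖y‖ := by
  refine (sq_le_sq₀ (norm_nonneg _) (by positivity)).1 ?_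
  rw [mul_pow, EuclideanSpace.real_norm_sq_eq, EuclideanSpace.real_norm_sq_eq, Finset.mul_sum]
  refine Finset.sum_le_sum fun i _ => ?_
  rw [← sq_abs, ← sq_abs (y i), ← mul_pow]
  exact pow_le_pow_left₀ (abs_nonneg _) (h i) 2

lemma norm_sub_cell_le {N : ℕ} {h : ℝ} (hh : 0 < h) (y : EuclideanSpace ℝ (Fin N)) :
    ‖y - h • latticePoint (cellIndex h y)‖ ≤ N * h := by
  refine (sq_le_sq₀ (norm_nonneg _) (by positivity)).1 ?_
  rw [EuclideanSpace.real_norm_sq_eq]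
  have hy := (cellIndex_eq_iff hh y _).1 rfl
  calc ∑ i, (y - h • latticePoint (cellIndex h y)) i ^ 2 ≤ ∑ _i : Fin N, h ^ 2 := by
        refine Finset.sum_le_sum fun i _ => ?_
        obtain ⟨h1, h2⟩ := hy i
        simp only [PiLp.sub_apply, PiLp.smul_apply, latticePoint_apply, smul_eq_mul]
        nlinarith
    _ = N * h ^ 2 := by simp
    _ ≤ (N * h) ^ 2 := by
        rw [mul_pow]
        gcongr
        have : N ≤ N ^ 2 := Nat.le_self_pow two_ne_zero N
        exact_mod_cast this

/-- Coordinatewise: if `k ≠ 0` then `|y i| ≥ h |k| - h / 2 ≥ h |k| / 2`, hence the factor `2`. -/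
lemma norm_cell_le {N : ℕ} {h : ℝ} (hh : 0 < h) (y : EuclideanSpace ℝ (Fin N)) :
    ‖h • latticePoint (cellIndex h y)‖ ≤ 2 * ‖y‖ := by
  refine norm_le_of_forall_abs_le zero_le_two fun i => ?_
  have hy := (cellIndex_eq_iff hh y _).1 rfl i
  set k := cellIndex h y i
  simp only [PiLp.smul_apply, latticePoint_apply, smul_eq_mul]
  obtain ⟨h1, h2⟩ := hy
  rcases lt_trichotomy k 0 with hk | hk | hk
  · have : (k : ℝ) ≤ -1 := by exact_mod_cast Int.le_sub_one_of_lt hk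
    rw [abs_of_nonpos (by nlinarith), abs_of_nonpos (by nlinarith)]
    nlinarith
  · simp [k, hk]
  · have : (1 : ℝ) ≤ k := by exact_mod_cast hk
    rw [abs_of_nonneg (by nlinarith), abs_of_nonneg (by nlinarith)]
    nlinarith

/-- Outside the central cell the centre has norm at least `h`, which absorbs the error `N h`. -/
lemma norm_le_norm_cell {N : ℕ} {h : ℝ} (hh : 0 < h) {y : EuclideanSpace ℝ (Fin N)}
    (hk : cellIndex h y ≠ 0) : ‖y‖ ≤ (1 + N) * ‖h • latticePoint (cellIndex h y)‖ := by
  have h1 := norm_sub_cell_le hh y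
  have h2 := norm_le_norm_sub_add y (h • latticePoint (cellIndex h y))
  have h3 : h ≤ ‖h • latticePoint (cellIndex h y)‖ := by
    rw [norm_smul, Real.norm_of_nonneg hh.le]
    nlinarith [one_le_norm_latticePoint hk]
  have : (N : ℝ) * h ≤ N * ‖h • latticePoint (cellIndex h y)‖ := by gcongr
  linarith

lemma levyKernel_zero_right {N : ℕ} (β : ℝ) (ξ : EuclideanSpace ℝ (Fin N)) :
    levyKernel β ξ 0 = 0 := by
  simp [levyKernel]

/-- The bound is uniform in `h`. Off the central cell `y` and its cell centre have comparable norms: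
`4` is the square of the factor `2`, and the power of `1 + N` comes from the denominator. On the
central cell the comparison fails, but the kernel is `0` there. -/
lemma levyKernel_cell_le {N : ℕ} {h β : ℝ} (hh : 0 < h) (h0 : 0 < β)
    (ξ y : EuclideanSpace ℝ (Fin N)) :
    levyKernel β ξ (h • latticePoint (cellIndex h y)) ≤
      2 * (1 + ‖ξ‖ ^ 2) * 4 * (1 + N) ^ ((N : ℝ) + β) *
        (min 1 (‖y‖ ^ 2) / ‖y‖ ^ ((N : ℝ) + β)) := by
  by_cases hk : cellIndex h y = 0
  · rw [hk, latticePoint_zero, smul_zero, levyKernel_zero_right]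
    positivity
  have h1 := norm_cell_le hh y
  have h2 := norm_le_norm_cell hh hk
  have hz : 0 < ‖h • latticePoint (cellIndex h y)‖ :=
    norm_pos_iff.2 (smul_ne_zero hh.ne' (latticePoint_ne_zero hk))
  refine (levyKernel_le β ξ _).trans ?_
  generalize ‖h • latticePoint (cellIndex h y)‖ = z at h1 h2 hz
  have hy : 0 < ‖y‖ := by linarith
  have h3 : min 1 (z ^ 2) ≤ 4 * min 1 (‖y‖ ^ 2) := by
    rw [mul_min_of_nonneg _ _ (by norm_num)]
    refine min_le_min (by norm_num) ?_
    calc z ^ 2 ≤ (2 * ‖y‖) ^ 2 := by gcongr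
      _ = 4 * ‖y‖ ^ 2 := by ring
  have h4 : ‖y‖ ^ ((N : ℝ) + β) ≤ (1 + N) ^ ((N : ℝ) + β) * z ^ ((N : ℝ) + β) := by
    rw [← Real.mul_rpow (by positivity) hz.le]
    gcongr
  rw [mul_assoc (2 * (1 + ‖ξ‖ ^ 2)), mul_assoc (2 * (1 + ‖ξ‖ ^ 2))]
  refine mul_le_mul_of_nonneg_left ?_ (by positivity)
  rw [← mul_div_assoc, div_le_div_iff₀ (by positivity) (by positivity)]
  calc min 1 (z ^ 2) * ‖y‖ ^ ((N : ℝ) + β)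
      ≤ (4 * min 1 (‖y‖ ^ 2)) * ((1 + N) ^ ((N : ℝ) + β) * z ^ ((N : ℝ) + β)) := by gcongr
    _ = _ := by ring

lemma continuousAt_levyKernel {N : ℕ} (β : ℝ) (ξ : EuclideanSpace ℝ (Fin N))
    {y : EuclideanSpace ℝ (Fin N)} (hy : y ≠ 0) : ContinuousAt (levyKernel β ξ) y := by
  unfold levyKernel
  have hy' : ‖y‖ ≠ 0 := norm_ne_zero_iff.2 hy
  refine ContinuousAt.div (by fun_prop) ?_ (by positivity)
  exact ContinuousAt.rpow_const (by fun_prop) (Or.inl hy')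

lemma measurable_levyKernel_cell {N : ℕ} (h β : ℝ) (ξ : EuclideanSpace ℝ (Fin N)) :
    Measurable (fun y => levyKernel β ξ (h • latticePoint (cellIndex h y))) :=
  (measurable_of_countable fun k : Fin N → ℤ => levyKernel β ξ (h • latticePoint k)).comp
    (measurable_cellIndex h)

lemma summable_levyKernel {N : ℕ} [NeZero N] {h β : ℝ} (hh : 0 < h) (h0 : 0 < β) (h2 : β < 2)
    (ξ : EuclideanSpace ℝ (Fin N)) :
    Summable (fun k : Fin N → ℤ => levyKernel β ξ (h • latticePoint k)) := by
  rw [← integrable_comp_cellIndex_iff hh]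
  refine ((integrable_min_one_sq_div_rpow (N := N) h0 h2).const_mul
    (2 * (1 + ‖ξ‖ ^ 2) * 4 * (1 + N) ^ ((N : ℝ) + β))).mono'
    (measurable_levyKernel_cell h β ξ).aestronglyMeasurable (ae_of_all _ fun y => ?_)
  rw [Real.norm_of_nonneg (levyKernel_nonneg _ _ _)]
  exact levyKernel_cell_le hh h0 ξ y

/-- The Riemann sums of the Lévy kernel over the lattice `h ℤ^N` converge to its integral. -/
theorem tendsto_riemannSum_levyKernel {N : ℕ} [NeZero N] {β : ℝ} (h0 : 0 < β) (h2 : β < 2)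
    (ξ : EuclideanSpace ℝ (Fin N)) :
    Tendsto (fun h : ℝ => h ^ N * ∑' k : Fin N → ℤ, levyKernel β ξ (h • latticePoint k))
      (𝓝[>] 0) (𝓝 (∫ y, levyKernel β ξ y)) := by
  have hlim : Tendsto (fun h : ℝ => ∫ y : EuclideanSpace ℝ (Fin N),
      levyKernel β ξ (h • latticePoint (cellIndex h y))) (𝓝[>] 0)
      (𝓝 (∫ y, levyKernel β ξ y)) := by
    refine tendsto_integral_filter_of_dominated_convergence _
      (Eventually.of_forall fun h => (measurable_levyKernel_cell h β ξ).aestronglyMeasurable) ?_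
      ((integrable_min_one_sq_div_rpow (N := N) h0 h2).const_mul
        (2 * (1 + ‖ξ‖ ^ 2) * 4 * (1 + N) ^ ((N : ℝ) + β))) ?_
    · filter_upwards [self_mem_nhdsWithin] with h hh
      refine ae_of_all _ fun y => ?_
      rw [Real.norm_of_nonneg (levyKernel_nonneg _ _ _)]
      exact levyKernel_cell_le hh h0 ξ y
    -- The kernel is continuous away from the origin, which is a null set, and the cell centres
    -- converge to `y`.
    · filter_upwards [Measure.ae_ne volume (0 : EuclideanSpace ℝ (Fin N))] with y hy
      refine (continuousAt_levyKernel β ξ hy).tendsto.comp ?_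
      rw [tendsto_iff_norm_sub_tendsto_zero]
      have hN : Tendsto (fun h : ℝ => N * h) (𝓝[>] 0) (𝓝 0) := by
        have : Tendsto (fun h : ℝ => N * h) (𝓝 0) (𝓝 (N * 0)) :=
          (continuous_const_mul (N : ℝ)).tendsto 0
        rw [mul_zero] at this
        exact this.mono_left nhdsWithin_le_nhds
      refine squeeze_zero' (Eventually.of_forall fun _ => norm_nonneg _) ?_ hN
      filter_upwards [self_mem_nhdsWithin] with h hh
      rw [norm_sub_rev]
      exact norm_sub_cell_le hh y
  refine hlim.congr' ?_
  filter_upwards [self_mem_nhdsWithin] with h hh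
  exact integral_comp_cellIndex hh (fun k => levyKernel β ξ (h • latticePoint k))

/-! ### Functions of positive type and the nonnegativity of stable densities. -/

/-- The bounded measurable functions all of whose Gaussian-regularised cosine transforms are
nonnegative. -/
structure IsPosType {N : ℕ} (f : EuclideanSpace ℝ (Fin N) → ℝ) : Prop where
  measurable : Measurable f
  bounded : ∃ C : ℝ, ∀ ξ, ‖f ξ‖ ≤ C
  integral_nonneg : ∀ δ : ℝ, 0 < δ → ∀ x : EuclideanSpace ℝ (Fin N),
    0 ≤ ∫ ξ, f ξ * (Real.cos (inner ℝ ξ x) * Real.exp (-δ * ‖ξ‖ ^ 2))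

namespace IsPosType

variable {N : ℕ} {f g w : EuclideanSpace ℝ (Fin N) → ℝ}

lemma integrable_mul (hf : IsPosType f) {δ : ℝ} (hδ : 0 < δ) (x : EuclideanSpace ℝ (Fin N)) :
    Integrable (fun ξ => f ξ * (Real.cos (inner ℝ ξ x) * Real.exp (-δ * ‖ξ‖ ^ 2))) := by
  obtain ⟨C, hC⟩ := hf.bounded
  exact (integrable_cos_inner_mul (integrable_exp_neg_mul_sq_norm hδ) x).bdd_mul
    hf.measurable.aestronglyMeasurable (ae_of_all _ hC)

lemma one : IsPosType (fun _ : EuclideanSpace ℝ (Fin N) => (1 : ℝ)) where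
  measurable := measurable_const
  bounded := ⟨1, fun _ => by simp⟩
  integral_nonneg δ hδ x := by
    simp_rw [one_mul]
    rw [integral_cos_inner_mul_exp hδ]
    positivity

lemma add (hf : IsPosType f) (hg : IsPosType g) : IsPosType (fun ξ => f ξ + g ξ) where
  measurable := hf.measurable.add hg.measurable
  bounded := by
    obtain ⟨C, hC⟩ := hf.bounded
    obtain ⟨D, hD⟩ := hg.bounded
    exact ⟨C + D, fun ξ => (norm_add_le _ _).trans (add_le_add (hC ξ) (hD ξ))⟩
  integral_nonneg δ hδ x := by
    simp_rw [add_mul]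
    rw [integral_add (hf.integrable_mul hδ x) (hg.integrable_mul hδ x)]
    exact add_nonneg (hf.integral_nonneg δ hδ x) (hg.integral_nonneg δ hδ x)

lemma const_mul (hf : IsPosType f) {c : ℝ} (hc : 0 ≤ c) : IsPosType (fun ξ => c * f ξ) where
  measurable := hf.measurable.const_mul c
  bounded := by
    obtain ⟨C, hC⟩ := hf.bounded
    refine ⟨‖c‖ * C, fun ξ => ?_⟩
    rw [norm_mul]
    gcongr
    exact hC ξ
  integral_nonneg δ hδ x := by
    simp_rw [mul_assoc]
    rw [integral_const_mul]
    exact mul_nonneg hc (hf.integral_nonneg δ hδ x)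

lemma of_tendsto {F : ℕ → EuclideanSpace ℝ (Fin N) → ℝ} (hF : ∀ n, IsPosType (F n)) {C : ℝ}
    (hC : ∀ n ξ, ‖F n ξ‖ ≤ C) (hlim : ∀ ξ, Tendsto (fun n => F n ξ) atTop (𝓝 (f ξ))) :
    IsPosType f where
  measurable := measurable_of_tendsto_metrizable (fun n => (hF n).measurable)
    (tendsto_pi_nhds.2 hlim)
  bounded := ⟨C, fun ξ => le_of_tendsto' (hlim ξ).norm fun n => hC n ξ⟩
  integral_nonneg δ hδ x := by
    have hi := integrable_cos_inner_mul (integrable_exp_neg_mul_sq_norm (N := N) hδ) x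
    refine ge_of_tendsto' (tendsto_integral_of_dominated_convergence
      (fun ξ => C * ‖Real.cos (inner ℝ ξ x) * Real.exp (-δ * ‖ξ‖ ^ 2)‖)
      (fun n => ((hF n).integrable_mul hδ x).aestronglyMeasurable) (hi.norm.const_mul C)
      (fun n => ae_of_all _ fun ξ => ?_)
      (ae_of_all _ fun ξ => (hlim ξ).mul_const _)) fun n => (hF n).integral_nonneg δ hδ x
    rw [norm_mul]
    gcongr
    exact hC n ξ

end IsPosType

/-- The cosine transform of a weight function. -/
def cosTransform {N : ℕ} (w : EuclideanSpace ℝ (Fin N) → ℝ) (ξ : EuclideanSpace ℝ (Fin N)) : ℝ :=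
  ∫ y, Real.cos (inner ℝ y ξ) * w y

lemma abs_cosTransform_le {N : ℕ} {w : EuclideanSpace ℝ (Fin N) → ℝ} (h0 : ∀ y, 0 ≤ w y)
    (hw : Integrable w) (ξ : EuclideanSpace ℝ (Fin N)) : |cosTransform w ξ| ≤ ∫ y, w y := by
  rw [← Real.norm_eq_abs, cosTransform]
  refine norm_integral_le_of_norm_le hw (ae_of_all _ fun y => ?_)
  rw [norm_mul, Real.norm_of_nonneg (h0 y)]
  exact mul_le_of_le_one_left (h0 y) (Real.abs_cos_le_one _)

lemma continuous_cosTransform {N : ℕ} {w : EuclideanSpace ℝ (Fin N) → ℝ}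
    (hw : Integrable w) : Continuous (cosTransform w) := by
  refine continuous_of_dominated (bound := fun y => ‖w y‖)
    (fun ξ => (integrable_cos_inner_mul hw ξ).aestronglyMeasurable)
    (fun ξ => ae_of_all _ fun y => ?_) hw.norm (ae_of_all _ fun y => by fun_prop)
  rw [norm_mul]
  exact mul_le_of_le_one_left (norm_nonneg _) (Real.abs_cos_le_one _)

namespace IsPosType

variable {N : ℕ} {f g w : EuclideanSpace ℝ (Fin N) → ℝ}

/-- The product formula for cosines turns multiplication by `cos ⟪y, ξ⟫` into the average of the
shifts `x - y` and `x + y`, and these are integrated against `w ≥ 0`. Multiplying by a cosine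
transform is all that is needed, so products of general functions of positive type are avoided. -/
lemma mul_cosTransform (hf : IsPosType f) (h0 : ∀ y, 0 ≤ w y) (hw : Integrable w) :
    IsPosType (fun ξ => f ξ * cosTransform w ξ) where
  measurable := hf.measurable.mul (continuous_cosTransform hw).measurable
  bounded := by
    obtain ⟨C, hC⟩ := hf.bounded
    refine ⟨C * ∫ y, w y, fun ξ => ?_⟩
    rw [norm_mul]
    exact mul_le_mul (hC ξ) (abs_cosTransform_le h0 hw ξ) (norm_nonneg _)
      ((norm_nonneg _).trans (hC ξ))
  integral_nonneg δ hδ x := by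
    have hint : Integrable (Function.uncurry fun ξ y : EuclideanSpace ℝ (Fin N) =>
        Real.cos (inner ℝ y ξ) *
          ((f ξ * (Real.cos (inner ℝ ξ x) * Real.exp (-δ * ‖ξ‖ ^ 2))) * w y))
        (volume.prod volume) :=
      ((hf.integrable_mul hδ x).mul_prod hw).bdd_mul (c := 1)
        (Measurable.aestronglyMeasurable (by fun_prop))
        (ae_of_all _ fun z => Real.abs_cos_le_one _)
    have h1 : ∀ ξ, f ξ * cosTransform w ξ * (Real.cos (inner ℝ ξ x) * Real.exp (-δ * ‖ξ‖ ^ 2)) =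
        ∫ y, Real.cos (inner ℝ y ξ) *
          ((f ξ * (Real.cos (inner ℝ ξ x) * Real.exp (-δ * ‖ξ‖ ^ 2))) * w y) := by
      intro ξ
      rw [cosTransform, mul_right_comm, ← integral_const_mul]
      refine integral_congr_ae (ae_of_all _ fun y => ?_)
      simp only
      ring
    simp_rw [h1]
    rw [integral_integral_swap hint]
    refine MeasureTheory.integral_nonneg fun y => ?_
    have h2 : ∀ ξ, Real.cos (inner ℝ y ξ) *
          ((f ξ * (Real.cos (inner ℝ ξ x) * Real.exp (-δ * ‖ξ‖ ^ 2))) * w y) =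
        w y / 2 * (f ξ * (Real.cos (inner ℝ ξ (x - y)) * Real.exp (-δ * ‖ξ‖ ^ 2)) +
          f ξ * (Real.cos (inner ℝ ξ (x + y)) * Real.exp (-δ * ‖ξ‖ ^ 2))) := by
      intro ξ
      rw [inner_sub_right, inner_add_right, Real.cos_sub, Real.cos_add, real_inner_comm ξ y]
      ring
    simp_rw [h2]
    rw [integral_const_mul, integral_add (hf.integrable_mul hδ _) (hf.integrable_mul hδ _)]
    exact mul_nonneg (div_nonneg (h0 y) zero_le_two)
      (add_nonneg (hf.integral_nonneg δ hδ _) (hf.integral_nonneg δ hδ _))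

lemma mul_one_add_pow (hf : IsPosType f) (h0 : ∀ y, 0 ≤ w y) (hw : Integrable w) {c : ℝ}
    (hc : 0 ≤ c) (n : ℕ) : IsPosType (fun ξ => f ξ * (1 + c * cosTransform w ξ) ^ n) := by
  induction n with
  | zero => simpa using hf
  | succ n ih =>
    convert ih.add ((ih.mul_cosTransform h0 hw).const_mul hc) using 2 with ξ
    ring

lemma mul_exp_cosTransform (hf : IsPosType f) (h0 : ∀ y, 0 ≤ w y) (hw : Integrable w) :
    IsPosType (fun ξ => f ξ * Real.exp (cosTransform w ξ)) := by
  obtain ⟨C, hC⟩ := hf.bounded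
  refine of_tendsto (F := fun n ξ => f ξ * (1 + 1 / (n : ℝ) * cosTransform w ξ) ^ n)
    (C := C * Real.exp (∫ y, w y))
    (fun n => hf.mul_one_add_pow h0 hw (by positivity) n) (fun n ξ => ?_) (fun ξ => ?_)
  · rw [norm_mul, norm_pow]
    refine mul_le_mul (hC ξ) ?_ (by positivity) ((norm_nonneg _).trans (hC ξ))
    have hb := abs_cosTransform_le h0 hw ξ
    have hI : 0 ≤ ∫ y, w y := MeasureTheory.integral_nonneg h0
    -- At `n = 0` the factor is an empty product, equal to `1`.
    rcases n.eq_zero_or_pos with rfl | hn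
    · simpa using hI
    have hn' : (0 : ℝ) < n := by exact_mod_cast hn
    have h1 : ‖1 + 1 / (n : ℝ) * cosTransform w ξ‖ ≤ Real.exp ((∫ y, w y) / n) := by
      calc ‖1 + 1 / (n : ℝ) * cosTransform w ξ‖
          ≤ ‖(1 : ℝ)‖ + ‖1 / (n : ℝ) * cosTransform w ξ‖ := norm_add_le _ _
        _ ≤ 1 + 1 / n * ∫ y, w y := by
            rw [norm_one, norm_mul, Real.norm_of_nonneg (by positivity)]
            gcongr
            exact hb
        _ = (∫ y, w y) / n + 1 := by ring
        _ ≤ _ := Real.add_one_le_exp _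
    calc ‖1 + 1 / (n : ℝ) * cosTransform w ξ‖ ^ n ≤ Real.exp ((∫ y, w y) / n) ^ n := by gcongr
      _ = Real.exp (∫ y, w y) := by
          rw [← Real.exp_nat_mul]
          congr 1
          field_simp
  · refine Tendsto.const_mul (f ξ) ((Real.tendsto_one_add_div_pow_exp _).congr fun n => ?_)
    ring

lemma mul_exp_integral_one_sub_cos (hf : IsPosType f) (h0 : ∀ y, 0 ≤ w y) (hw : Integrable w) :
    IsPosType (fun ξ => f ξ * Real.exp (-∫ y, (1 - Real.cos (inner ℝ y ξ)) * w y)) := by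
  have h := (hf.mul_exp_cosTransform h0 hw).const_mul (Real.exp_pos (-∫ y, w y)).le
  convert h using 2 with ξ
  simp_rw [sub_mul, one_mul]
  rw [integral_sub hw (integrable_cos_inner_mul hw ξ), neg_sub, sub_eq_neg_add, Real.exp_add,
    cosTransform]
  ring

lemma mul_exp_neg_rpow [NeZero N] (hf : IsPosType f) {c β : ℝ} (hc : 0 ≤ c) (h0 : 0 < β)
    (h2 : β < 2) : IsPosType (fun ξ => f ξ * Real.exp (-(c * ‖ξ‖ ^ β))) := by
  obtain ⟨C, hC⟩ := hf.bounded
  set b := 2 * normConst N β with hb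
  have hb0 : 0 < b := mul_pos two_pos (normConst_pos h0 h2)
  -- The cutoff `min 1 (n ‖y‖ ^ 2)` makes the Lévy density integrable at the origin; for each `y ≠
  -- 0` it equals `1` once `n ≥ 1 / ‖y‖ ^ 2`.
  let w : ℕ → EuclideanSpace ℝ (Fin N) → ℝ := fun n y =>
    c * b * (min 1 (n * ‖y‖ ^ 2) / ‖y‖ ^ ((N : ℝ) + β))
  have hw0 : ∀ n y, 0 ≤ w n y := fun n y => by positivity
  have hwi : ∀ n, Integrable (w n) := by
    intro n
    refine ((integrable_min_one_sq_div_rpow (N := N) h0 h2).const_mul (c * b * (1 + n))).mono'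
      (Measurable.aestronglyMeasurable (by fun_prop)) (ae_of_all _ fun y => ?_)
    rw [Real.norm_of_nonneg (hw0 n y), mul_assoc, ← mul_div_assoc]
    simp only [w]
    gcongr
    rw [mul_min_of_nonneg _ _ (by positivity)]
    refine min_le_min (by simp) ?_
    nlinarith [sq_nonneg ‖y‖]
  have hlim : ∀ ξ, Tendsto (fun n => ∫ y, (1 - Real.cos (inner ℝ y ξ)) * w n y) atTop
      (𝓝 (c * ‖ξ‖ ^ β)) := by
    intro ξ
    rw [← normConst_mul_integral_levyKernel h0 h2 ξ, ← hb, ← mul_assoc, ← integral_const_mul]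
    refine tendsto_integral_of_dominated_convergence (fun y => c * b * levyKernel β ξ y)
      (fun n => Measurable.aestronglyMeasurable (by fun_prop))
      ((integrable_levyKernel h0 h2 ξ).const_mul _) (fun n => ae_of_all _ fun y => ?_) ?_
    · have hcos : 0 ≤ 1 - Real.cos (inner ℝ y ξ) := by
        linarith [Real.cos_le_one (inner ℝ y ξ)]
      rw [Real.norm_of_nonneg (mul_nonneg hcos (hw0 n y)), levyKernel]
      calc (1 - Real.cos (inner ℝ y ξ)) * w n y
          ≤ (1 - Real.cos (inner ℝ y ξ)) * (c * b * (1 / ‖y‖ ^ ((N : ℝ) + β))) := by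
            simp only [w]
            gcongr
            exact min_le_left _ _
        _ = _ := by ring
    · filter_upwards [Measure.ae_ne volume (0 : EuclideanSpace ℝ (Fin N))] with y hy
      have hy' : 0 < ‖y‖ ^ 2 := by positivity
      refine tendsto_const_nhds.congr' ?_
      obtain ⟨n₀, hn₀⟩ := exists_nat_ge (1 / ‖y‖ ^ 2)
      filter_upwards [eventually_ge_atTop n₀] with n hn
      have h1 : (1 : ℝ) ≤ n * ‖y‖ ^ 2 := by
        rw [← div_le_iff₀ hy']
        exact hn₀.trans (by exact_mod_cast hn)
      simp only [w]
      rw [min_eq_left h1, levyKernel]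
      ring
  refine of_tendsto (F := fun n ξ =>
    f ξ * Real.exp (-∫ y, (1 - Real.cos (inner ℝ y ξ)) * w n y)) (C := C)
    (fun n => hf.mul_exp_integral_one_sub_cos (hw0 n) (hwi n)) (fun n ξ => ?_) (fun ξ => ?_)
  · rw [norm_mul, Real.norm_of_nonneg (Real.exp_pos _).le]
    refine (mul_le_of_le_one_right (norm_nonneg _) ?_).trans (hC ξ)
    rw [Real.exp_le_one_iff, neg_nonpos]
    exact MeasureTheory.integral_nonneg fun y =>
      mul_nonneg (by linarith [Real.cos_le_one (inner ℝ y ξ)]) (hw0 n y)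
  · exact ((Real.continuous_exp.tendsto _).comp (hlim ξ).neg).const_mul (f ξ)

end IsPosType

/-! ### The fundamental solution as a probability density. -/

/-- The Fourier transform `exp (t B (2πξ))` of the fundamental solution at time `t`. -/
def symbolExp {N M : ℕ} (a α : Fin M → ℝ) (t : ℝ) (ξ : EuclideanSpace ℝ (Fin N)) : ℝ :=
  Real.exp (t * multitermSymbol a α ((2 * Real.pi) • ξ))

/-- The fundamental solution. -/
def fundamentalSolution {N M : ℕ} (a α : Fin M → ℝ) (t : ℝ) (x : EuclideanSpace ℝ (Fin N)) : ℝ :=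
  ∫ ξ, symbolExp a α t ξ * Real.cos (2 * Real.pi * inner ℝ ξ x)

section

variable {N M : ℕ} {a α : Fin M → ℝ}

lemma multitermSymbol_smul (a α : Fin M → ℝ) (ξ : EuclideanSpace ℝ (Fin N)) :
    multitermSymbol a α ((2 * Real.pi) • ξ) =
      -∑ m, a m * (2 * Real.pi) ^ α m * ‖ξ‖ ^ α m := by
  rw [multitermSymbol, neg_inj]
  refine Finset.sum_congr rfl fun m _ => ?_
  rw [norm_smul, Real.norm_of_nonneg (by positivity), Real.mul_rpow (by positivity)
    (norm_nonneg _), mul_assoc]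

lemma multitermSymbol_nonpos (ha : ∀ m, 0 < a m) (ξ : EuclideanSpace ℝ (Fin N)) :
    multitermSymbol a α ξ ≤ 0 := by
  rw [multitermSymbol, neg_nonpos]
  exact Finset.sum_nonneg fun m _ => mul_nonneg (ha m).le (by positivity)

lemma multitermSymbol_zero (hα : ∀ m, 0 < α m) :
    multitermSymbol a α (0 : EuclideanSpace ℝ (Fin N)) = 0 := by
  simp [multitermSymbol, Real.zero_rpow (hα _).ne']

lemma continuous_multitermSymbol (hα : ∀ m, 0 < α m) :
    Continuous (multitermSymbol a α : EuclideanSpace ℝ (Fin N) → ℝ) := by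
  unfold multitermSymbol
  refine (continuous_finsetSum _ fun m _ => continuous_const.mul ?_).neg
  exact continuous_norm.rpow_const fun _ => Or.inr (hα m).le

lemma continuous_multitermSymbol_smul (hα : ∀ m, 0 < α m) :
    Continuous (fun ξ : EuclideanSpace ℝ (Fin N) =>
      multitermSymbol a α ((2 * Real.pi) • ξ)) :=
  (continuous_multitermSymbol hα).comp (continuous_const_smul _)

lemma continuous_symbolExp (hα : ∀ m, 0 < α m) (t : ℝ) :
    Continuous (symbolExp a α t : EuclideanSpace ℝ (Fin N) → ℝ) :=
  Real.continuous_exp.comp (continuous_const.mul (continuous_multitermSymbol_smul hα))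

lemma symbolExp_pos (a α : Fin M → ℝ) (t : ℝ) (ξ : EuclideanSpace ℝ (Fin N)) :
    0 < symbolExp a α t ξ := Real.exp_pos _

lemma symbolExp_le_one (ha : ∀ m, 0 < a m) {t : ℝ} (ht : 0 ≤ t) (ξ : EuclideanSpace ℝ (Fin N)) :
    symbolExp a α t ξ ≤ 1 :=
  Real.exp_le_one_iff.2 (mul_nonpos_of_nonneg_of_nonpos ht (multitermSymbol_nonpos ha _))

lemma symbolExp_neg (a α : Fin M → ℝ) (t : ℝ) (ξ : EuclideanSpace ℝ (Fin N)) :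
    symbolExp a α t (-ξ) = symbolExp a α t ξ := by
  simp [symbolExp, multitermSymbol]

lemma symbolExp_zero (hα : ∀ m, 0 < α m) (t : ℝ) :
    symbolExp a α t (0 : EuclideanSpace ℝ (Fin N)) = 1 := by
  simp [symbolExp, multitermSymbol_zero hα]

lemma integrable_exp_neg_mul_norm_rpow [NeZero N] {b p : ℝ} (hb : 0 < b) (hp : 0 < p) :
    Integrable (fun ξ : EuclideanSpace ℝ (Fin N) => Real.exp (-b * ‖ξ‖ ^ p)) := by
  rw [integrable_fun_norm_addHaar volume (f := fun r : ℝ => Real.exp (-b * r ^ p)),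
    finrank_euclideanSpace_fin]
  refine (integrableOn_rpow_mul_exp_neg_mul_rpow (s := (N - 1 : ℕ))
    (by have : (0 : ℝ) ≤ ((N - 1 : ℕ) : ℝ) := by positivity
        linarith) hp hb).congr_fun ?_ measurableSet_Ioi
  intro r _
  simp only [Real.rpow_natCast, smul_eq_mul]

lemma integrable_symbolExp [NeZero N] [NeZero M] (ha : ∀ m, 0 < a m) (hα : ∀ m, 0 < α m) {t : ℝ}
    (ht : 0 < t) : Integrable (symbolExp a α t : EuclideanSpace ℝ (Fin N) → ℝ) := by
  have ha0 := ha 0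
  have hb : 0 < t * (a 0 * (2 * Real.pi) ^ α 0) := by positivity
  refine (integrable_exp_neg_mul_norm_rpow (N := N) hb (hα 0)).mono'
    (continuous_symbolExp hα t).aestronglyMeasurable (ae_of_all _ fun ξ => ?_)
  rw [Real.norm_of_nonneg (symbolExp_pos _ _ _ _).le, symbolExp, Real.exp_le_exp,
    multitermSymbol_smul, neg_mul, mul_neg, neg_le_neg_iff, mul_assoc]
  refine mul_le_mul_of_nonneg_left ?_ ht.le
  refine Finset.single_le_sum (f := fun m => a m * (2 * Real.pi) ^ α m * ‖ξ‖ ^ α m)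
    (fun m _ => ?_) (Finset.mem_univ 0)
  have := ha m
  positivity

lemma isPosType_symbolExp [NeZero N] (ha : ∀ m, 0 < a m) (hα : ∀ m, 0 < α m)
    (hα2 : ∀ m, α m < 2) {t : ℝ} (ht : 0 ≤ t) :
    IsPosType (symbolExp a α t : EuclideanSpace ℝ (Fin N) → ℝ) := by
  have key : ∀ s : Finset (Fin M), IsPosType (fun ξ : EuclideanSpace ℝ (Fin N) =>
      Real.exp (-∑ m ∈ s, t * (a m * (2 * Real.pi) ^ α m) * ‖ξ‖ ^ α m)) := by
    intro s
    induction s using Finset.induction_on with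
    | empty => simpa using IsPosType.one
    | insert m s hm ih =>
      have := ha m
      convert ih.mul_exp_neg_rpow (c := t * (a m * (2 * Real.pi) ^ α m)) (by positivity)
        (hα m) (hα2 m) using 2 with ξ
      rw [Finset.sum_insert hm, neg_add, Real.exp_add, mul_comm]
  convert key Finset.univ using 2 with ξ
  rw [symbolExp, multitermSymbol_smul, mul_neg, Finset.mul_sum]
  congr 2
  refine Finset.sum_congr rfl fun m _ => ?_
  ring

/-- The Gaussian regulariser is removed by letting `δ → 0`, with the integrable function `symbolExp`
as dominating function. The argument `2π x` adjusts for the normalisation of the Fourier transform.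
-/
lemma fundamentalSolution_nonneg [NeZero N] [NeZero M] (ha : ∀ m, 0 < a m) (hα : ∀ m, 0 < α m)
    (hα2 : ∀ m, α m < 2) {t : ℝ} (ht : 0 < t) (x : EuclideanSpace ℝ (Fin N)) :
    0 ≤ fundamentalSolution a α t x := by
  have hf := isPosType_symbolExp (N := N) ha hα hα2 ht.le
  have hi := integrable_symbolExp (N := N) ha hα ht
  have hlim : Tendsto (fun δ : ℝ => ∫ ξ, symbolExp a α t ξ *
      (Real.cos (inner ℝ ξ ((2 * Real.pi) • x)) * Real.exp (-δ * ‖ξ‖ ^ 2))) (𝓝[>] 0)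
      (𝓝 (fundamentalSolution a α t x)) := by
    refine tendsto_integral_filter_of_dominated_convergence (symbolExp a α t) ?_ ?_ hi
      (ae_of_all _ fun ξ => ?_)
    · filter_upwards [self_mem_nhdsWithin] with δ hδ
      exact (hf.integrable_mul hδ _).aestronglyMeasurable
    · filter_upwards [self_mem_nhdsWithin] with δ hδ
      refine ae_of_all _ fun ξ => ?_
      have hδ' : 0 < δ := hδ
      rw [norm_mul, norm_mul, Real.norm_of_nonneg (symbolExp_pos _ _ _ _).le]
      refine mul_le_of_le_one_right (symbolExp_pos _ _ _ _).le (mul_le_one₀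
        (Real.abs_cos_le_one _) (norm_nonneg _) ?_)
      rw [Real.norm_of_nonneg (Real.exp_pos _).le, Real.exp_le_one_iff, neg_mul, neg_nonpos]
      positivity
    · refine Tendsto.mono_left ?_ nhdsWithin_le_nhds
      have : Continuous fun δ : ℝ => symbolExp a α t ξ *
          (Real.cos (inner ℝ ξ ((2 * Real.pi) • x)) * Real.exp (-δ * ‖ξ‖ ^ 2)) := by fun_prop
      simpa [inner_smul_right] using this.tendsto 0
  refine ge_of_tendsto hlim ?_
  filter_upwards [self_mem_nhdsWithin] with δ hδ using hf.integral_nonneg δ hδ _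

lemma fourier_symbolExp [NeZero N] [NeZero M] (ha : ∀ m, 0 < a m) (hα : ∀ m, 0 < α m) {t : ℝ}
    (ht : 0 < t) : 𝓕 (fun ξ : EuclideanSpace ℝ (Fin N) => (symbolExp a α t ξ : ℂ)) =
      fun x => (fundamentalSolution a α t x : ℂ) := by
  ext x
  have hi := integrable_symbolExp (N := N) ha hα ht
  rw [Real.fourier_eq']
  have hint : Integrable (fun ξ : EuclideanSpace ℝ (Fin N) =>
      Complex.exp (((-2 * Real.pi * inner ℝ ξ x : ℝ) : ℂ) * Complex.I) •
        (symbolExp a α t ξ : ℂ)) :=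
    hi.ofReal.bdd_mul (c := 1) (Continuous.aestronglyMeasurable (by fun_prop))
      (ae_of_all _ fun ξ => (Complex.norm_exp_ofReal_mul_I _).le)
  apply Complex.ext
  · rw [← RCLike.re_eq_complex_re, ← integral_re hint]
    simp only [RCLike.re_eq_complex_re, Complex.ofReal_re, smul_eq_mul, Complex.re_mul_ofReal,
      Complex.exp_ofReal_mul_I_re]
    rw [fundamentalSolution]
    refine integral_congr_ae (ae_of_all _ fun ξ => ?_)
    simp only
    rw [mul_comm, neg_mul, neg_mul, Real.cos_neg]
  · rw [← RCLike.im_eq_complex_im, ← integral_im hint]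
    simp only [RCLike.im_eq_complex_im, Complex.ofReal_im, smul_eq_mul, Complex.im_mul_ofReal,
      Complex.exp_ofReal_mul_I_im]
    -- The symbol is even, so the sine integral equals its own negative.
    have h := integral_neg_eq_self (fun ξ : EuclideanSpace ℝ (Fin N) =>
      Real.sin (-2 * Real.pi * inner ℝ ξ x) * symbolExp a α t ξ) volume
    simp only [symbolExp_neg, inner_neg_left, mul_neg, Real.sin_neg, neg_mul] at h
    rw [integral_neg] at h
    simp only [neg_mul, Real.sin_neg] at h ⊢
    linarith

lemma continuous_fundamentalSolution [NeZero N] [NeZero M] (ha : ∀ m, 0 < a m)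
    (hα : ∀ m, 0 < α m) {t : ℝ} (ht : 0 < t) :
    Continuous (fundamentalSolution a α t : EuclideanSpace ℝ (Fin N) → ℝ) := by
  refine continuous_of_dominated (bound := symbolExp a α t)
    (fun x => Continuous.aestronglyMeasurable
      ((continuous_symbolExp hα t).mul (by fun_prop)))
    (fun x => ae_of_all _ fun ξ => ?_) (integrable_symbolExp ha hα ht)
    (ae_of_all _ fun ξ => by fun_prop)
  rw [norm_mul, Real.norm_of_nonneg (symbolExp_pos _ _ _ _).le]
  exact mul_le_of_le_one_right (symbolExp_pos _ _ _ _).le (Real.abs_cos_le_one _)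

lemma integrable_fundamentalSolution_mul_exp [NeZero N] [NeZero M] (ha : ∀ m, 0 < a m)
    (hα : ∀ m, 0 < α m) {t ε : ℝ} (ht : 0 < t) (hε : 0 < ε) :
    Integrable (fun x : EuclideanSpace ℝ (Fin N) =>
      fundamentalSolution a α t x * Real.exp (-ε * ‖x‖ ^ 2)) := by
  refine (integrable_exp_neg_mul_sq_norm hε).bdd_mul (c := ∫ ξ : EuclideanSpace ℝ (Fin N),
    symbolExp a α t ξ)
    (continuous_fundamentalSolution ha hα ht).aestronglyMeasurable (ae_of_all _ fun x => ?_)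
  refine norm_integral_le_of_norm_le (integrable_symbolExp ha hα ht) (ae_of_all _ fun ξ => ?_)
  rw [norm_mul, Real.norm_of_nonneg (symbolExp_pos _ _ _ _).le]
  exact mul_le_of_le_one_right (symbolExp_pos _ _ _ _).le (Real.abs_cos_le_one _)

/-- Fubini moves the Gaussian to the frequency side, where it has mass `1` and is integrated against
a function at most `1`. The bound does not depend on `ε`. -/
lemma integral_fundamentalSolution_mul_exp_le [NeZero N] [NeZero M] (ha : ∀ m, 0 < a m)
    (hα : ∀ m, 0 < α m) {t ε : ℝ} (ht : 0 < t) (hε : 0 < ε) :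
    ∫ x : EuclideanSpace ℝ (Fin N),
      fundamentalSolution a α t x * Real.exp (-ε * ‖x‖ ^ 2) ≤ 1 := by
  have hi := integrable_symbolExp (N := N) ha hα ht
  have hg := integrable_exp_neg_mul_sq_norm (N := N) hε
  have hint : Integrable (Function.uncurry fun x ξ : EuclideanSpace ℝ (Fin N) =>
      Real.cos (2 * Real.pi * inner ℝ ξ x) *
        (Real.exp (-ε * ‖x‖ ^ 2) * symbolExp a α t ξ)) (volume.prod volume) :=
    (hg.mul_prod hi).bdd_mul (c := 1) (Measurable.aestronglyMeasurable (by fun_prop))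
      (ae_of_all _ fun z => Real.abs_cos_le_one _)
  have h1 : ∀ x : EuclideanSpace ℝ (Fin N),
      fundamentalSolution a α t x * Real.exp (-ε * ‖x‖ ^ 2) =
      ∫ ξ, Real.cos (2 * Real.pi * inner ℝ ξ x) *
        (Real.exp (-ε * ‖x‖ ^ 2) * symbolExp a α t ξ) := by
    intro x
    rw [fundamentalSolution, ← integral_mul_const]
    refine integral_congr_ae (ae_of_all _ fun ξ => ?_)
    simp only
    ring
  have h2 : ∀ ξ : EuclideanSpace ℝ (Fin N), ∫ x, Real.cos (2 * Real.pi * inner ℝ ξ x) *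
        (Real.exp (-ε * ‖x‖ ^ 2) * symbolExp a α t ξ) =
      symbolExp a α t ξ * ((Real.pi / ε) ^ ((N : ℝ) / 2) *
        Real.exp (-(Real.pi ^ 2 / ε) * ‖ξ‖ ^ 2)) := by
    intro ξ
    have h := integral_cos_inner_mul_exp hε ((2 * Real.pi) • ξ)
    have h3 : -‖(2 * Real.pi) • ξ‖ ^ 2 / (4 * ε) = -(Real.pi ^ 2 / ε) * ‖ξ‖ ^ 2 := by
      rw [norm_smul, Real.norm_of_nonneg (by positivity)]
      field_simp
      ring
    rw [h3] at h
    rw [← h, ← integral_const_mul]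
    refine integral_congr_ae (ae_of_all _ fun x => ?_)
    simp only [inner_smul_right, real_inner_comm ξ x]
    ring
  have hpi : 0 < Real.pi ^ 2 / ε := by positivity
  simp_rw [h1]
  rw [integral_integral_swap hint]
  simp_rw [h2]
  calc ∫ ξ : EuclideanSpace ℝ (Fin N), symbolExp a α t ξ * ((Real.pi / ε) ^ ((N : ℝ) / 2) *
        Real.exp (-(Real.pi ^ 2 / ε) * ‖ξ‖ ^ 2))
      ≤ ∫ ξ : EuclideanSpace ℝ (Fin N), (Real.pi / ε) ^ ((N : ℝ) / 2) *
        Real.exp (-(Real.pi ^ 2 / ε) * ‖ξ‖ ^ 2) := by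
        have hb := (integrable_exp_neg_mul_sq_norm (N := N) hpi).const_mul
          ((Real.pi / ε) ^ ((N : ℝ) / 2))
        refine integral_mono_of_nonneg (ae_of_all _ fun ξ => ?_) hb (ae_of_all _ fun ξ => ?_)
        · exact mul_nonneg (symbolExp_pos _ _ _ _).le (by positivity)
        · exact mul_le_of_le_one_left (by positivity) (symbolExp_le_one ha ht.le ξ)
    _ = 1 := by
        rw [integral_const_mul, GaussianFourier.integral_rexp_neg_mul_sq_norm hpi,
          finrank_euclideanSpace_fin, ← Real.mul_rpow (by positivity) (by positivity)]
        have : Real.pi / ε * (Real.pi / (Real.pi ^ 2 / ε)) = 1 := by field_simp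
        rw [this, Real.one_rpow]

/-- No decay estimate is used: as the function is nonnegative, Fatou's lemma with `ε = 1 / (n + 1)`
bounds its integral by `1`. -/
lemma integrable_fundamentalSolution [NeZero N] [NeZero M] (ha : ∀ m, 0 < a m)
    (hα : ∀ m, 0 < α m) (hα2 : ∀ m, α m < 2) {t : ℝ} (ht : 0 < t) :
    Integrable (fundamentalSolution a α t : EuclideanSpace ℝ (Fin N) → ℝ) := by
  have hc := continuous_fundamentalSolution (N := N) ha hα ht
  have hpos := fundamentalSolution_nonneg (N := N) ha hα hα2 ht
  refine ⟨hc.aestronglyMeasurable, ?_⟩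
  rw [hasFiniteIntegral_iff_ofReal (ae_of_all _ hpos)]
  let F : ℕ → EuclideanSpace ℝ (Fin N) → ENNReal := fun n x =>
    ENNReal.ofReal (fundamentalSolution a α t x * Real.exp (-(1 / ((n : ℝ) + 1)) * ‖x‖ ^ 2))
  have hF : ∀ n, Measurable (F n) := fun n =>
    (hc.measurable.mul (by fun_prop)).ennreal_ofReal
  have hlim : ∀ x, Tendsto (fun n => F n x) atTop
      (𝓝 (ENNReal.ofReal (fundamentalSolution a α t x))) := by
    intro x
    refine (ENNReal.continuous_ofReal.tendsto _).comp ?_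
    have h1 : Continuous fun s : ℝ => fundamentalSolution a α t x * Real.exp (-s * ‖x‖ ^ 2) := by
      fun_prop
    simpa [Function.comp_def] using (h1.tendsto 0).comp tendsto_one_div_add_atTop_nhds_zero_nat
  have hle : ∀ n, ∫⁻ x, F n x ≤ 1 := by
    intro n
    have hn : (0 : ℝ) < 1 / ((n : ℝ) + 1) := by positivity
    rw [← ofReal_integral_eq_lintegral_ofReal
      (integrable_fundamentalSolution_mul_exp ha hα ht hn)
      (ae_of_all _ fun x => mul_nonneg (hpos x) (Real.exp_pos _).le)]
    exact ENNReal.ofReal_le_one.2 (integral_fundamentalSolution_mul_exp_le ha hα ht hn)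
  calc ∫⁻ x, ENNReal.ofReal (fundamentalSolution a α t x)
      = ∫⁻ x, liminf (fun n => F n x) atTop := by
        simp_rw [(hlim _).liminf_eq]
    _ ≤ liminf (fun n => ∫⁻ x, F n x) atTop := lintegral_liminf_le hF
    _ ≤ 1 := by
        refine liminf_le_of_le (by isBoundedDefault) fun b hb => ?_
        obtain ⟨n, hn⟩ := hb.exists
        exact hn.trans (hle n)
    _ < ⊤ := ENNReal.one_lt_top

lemma fourierInv_fundamentalSolution [NeZero N] [NeZero M] (ha : ∀ m, 0 < a m)
    (hα : ∀ m, 0 < α m) (hα2 : ∀ m, α m < 2) {t : ℝ} (ht : 0 < t) :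
    𝓕⁻ (fun x : EuclideanSpace ℝ (Fin N) => (fundamentalSolution a α t x : ℂ)) =
      fun ξ => (symbolExp a α t ξ : ℂ) := by
  rw [← fourier_symbolExp ha hα ht]
  refine Continuous.fourierInv_fourier_eq
    (Complex.continuous_ofReal.comp (continuous_symbolExp hα t))
    (integrable_symbolExp ha hα ht).ofReal ?_
  rw [fourier_symbolExp ha hα ht]
  exact (integrable_fundamentalSolution ha hα hα2 ht).ofReal

lemma isProbDensity_fundamentalSolution [NeZero N] [NeZero M] (ha : ∀ m, 0 < a m)
    (hα : ∀ m, 0 < α m) (hα2 : ∀ m, α m < 2) {t : ℝ} (ht : 0 < t) :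
    IsProbDensity (fundamentalSolution a α t : EuclideanSpace ℝ (Fin N) → ℝ) where
  integrable := integrable_fundamentalSolution ha hα hα2 ht
  nonneg := ae_of_all _ (fundamentalSolution_nonneg ha hα hα2 ht)
  integral_eq_one := by
    have h := congrFun (fourierInv_fundamentalSolution (N := N) ha hα hα2 ht) 0
    rw [Real.fourierInv_eq', symbolExp_zero hα] at h
    simp only [inner_zero_right, mul_zero, Complex.ofReal_zero, zero_mul, Complex.exp_zero,
      one_smul, integral_complex_ofReal] at h
    exact_mod_cast h

end

/-! ### The weak equation on the Fourier side. -/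

section

variable {N : ℕ}

lemma integrable_complex_ofReal {f : EuclideanSpace ℝ (Fin N) → ℝ} (hf : Integrable f) :
    Integrable (fun x => (f x : ℂ)) :=
  hf.ofReal

lemma continuous_fourierInv {u : EuclideanSpace ℝ (Fin N) → ℂ} (hu : Integrable u) :
    Continuous (𝓕⁻ u) :=
  VectorFourier.fourierIntegral_continuous Real.continuous_fourierChar
    (by simp only [LinearMap.neg_apply, innerₗ_apply_apply]; fun_prop) hu

lemma norm_fourierInv_le (u : EuclideanSpace ℝ (Fin N) → ℂ) (ξ : EuclideanSpace ℝ (Fin N)) :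
    ‖𝓕⁻ u ξ‖ ≤ ∫ x, ‖u x‖ :=
  VectorFourier.norm_fourierIntegral_le_integral_norm _ _ _ u ξ

lemma integral_mul_fourierInv {u g : EuclideanSpace ℝ (Fin N) → ℂ} (hu : Integrable u)
    (hg : Integrable g) : ∫ x, u x * 𝓕⁻ g x = ∫ ξ, 𝓕⁻ u ξ * g ξ := by
  have h := VectorFourier.integral_fourierIntegral_smul_eq_flip (μ := volume) (ν := volume)
    (L := -innerₗ (EuclideanSpace ℝ (Fin N))) (f := u) (g := g) Real.continuous_fourierChar
    (by simp only [LinearMap.neg_apply, innerₗ_apply_apply]; fun_prop) hu hg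
  have hflip : (-innerₗ (EuclideanSpace ℝ (Fin N))).flip = -innerₗ _ := by
    ext x y
    simp [real_inner_comm]
  rw [hflip] at h
  exact h.symm

lemma integral_mul_eq_integral_fourierInv_mul_fourier {u : EuclideanSpace ℝ (Fin N) → ℂ}
    (hu : Integrable u) (φ : 𝓢(EuclideanSpace ℝ (Fin N), ℂ)) :
    ∫ x, u x * φ x = ∫ ξ, 𝓕⁻ u ξ * (𝓕 φ) ξ := by
  rw [← integral_mul_fourierInv hu (𝓕 φ).integrable, ← SchwartzMap.fourierInv_coe,
    FourierTransform.fourierInv_fourier_eq]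

lemma norm_rpow_le_one_add_sq {r p : ℝ} (hr : 0 ≤ r) (h0 : 0 ≤ p) (h2 : p ≤ 2) :
    r ^ p ≤ 1 + r ^ 2 := by
  rcases le_total r 1 with h | h
  · exact (Real.rpow_le_one hr h h0).trans (by nlinarith [sq_nonneg r])
  · have := Real.rpow_le_rpow_of_exponent_le h h2
    rw [Real.rpow_two] at this
    linarith

variable {M : ℕ} {a α : Fin M → ℝ}

/-- Each `‖ξ‖ ^ α m` is at most `1 + ‖ξ‖ ^ 2`, which the decay of a Schwartz function absorbs. -/
lemma integrable_multitermSymbol_mul (ha : ∀ m, 0 < a m) (hα : ∀ m, 0 < α m)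
    (hα2 : ∀ m, α m < 2) (φ : 𝓢(EuclideanSpace ℝ (Fin N), ℂ)) :
    Integrable (fun ξ : EuclideanSpace ℝ (Fin N) =>
      (multitermSymbol a α ((2 * Real.pi) • ξ) : ℂ) * φ ξ) := by
  have hφ := (φ.integrable (μ := volume)).norm.add (φ.integrable_pow_mul volume 2)
  refine (hφ.const_mul (∑ m, a m * (2 * Real.pi) ^ α m)).mono'
    (((Complex.continuous_ofReal.comp (continuous_multitermSymbol_smul hα)).mul
      φ.continuous).aestronglyMeasurable) (ae_of_all _ fun ξ => ?_)
  rw [norm_mul, Complex.norm_real, multitermSymbol_smul, norm_neg, Real.norm_of_nonneg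
    (Finset.sum_nonneg fun m _ => by have := ha m; positivity), Finset.sum_mul, Finset.sum_mul]
  refine Finset.sum_le_sum fun m _ => ?_
  have := ha m
  calc a m * (2 * Real.pi) ^ α m * ‖ξ‖ ^ α m * ‖φ ξ‖
      ≤ a m * (2 * Real.pi) ^ α m * (1 + ‖ξ‖ ^ 2) * ‖φ ξ‖ := by
        gcongr
        exact norm_rpow_le_one_add_sq (norm_nonneg _) (hα m).le (hα2 m).le
    _ = _ := by
        simp only [Pi.add_apply]
        ring

lemma integral_mul_multitermOp (ha : ∀ m, 0 < a m) (hα : ∀ m, 0 < α m)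
    (hα2 : ∀ m, α m < 2) {u : EuclideanSpace ℝ (Fin N) → ℂ} (hu : Integrable u)
    (φ : 𝓢(EuclideanSpace ℝ (Fin N), ℂ)) :
    ∫ x, u x * multitermOp a α φ x =
      ∫ ξ, 𝓕⁻ u ξ * ((multitermSymbol a α ((2 * Real.pi) • ξ) : ℂ) * (𝓕 φ) ξ) :=
  integral_mul_fourierInv hu (integrable_multitermSymbol_mul ha hα hα2 (𝓕 φ))

lemma integral_schwartz_fourier (φ : 𝓢(EuclideanSpace ℝ (Fin N), ℂ)) :
    ∫ ξ, (𝓕 φ) ξ = φ 0 := by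
  have h : 𝓕⁻ (𝓕 φ) = φ := FourierTransform.fourierInv_fourier_eq φ
  have h0 := congrArg (fun ψ : 𝓢(EuclideanSpace ℝ (Fin N), ℂ) => ψ 0) h
  rw [SchwartzMap.fourierInv_coe, Real.fourierInv_eq'] at h0
  simpa using h0

lemma hasDerivAt_integral_symbolExp_mul (ha : ∀ m, 0 < a m) (hα : ∀ m, 0 < α m)
    (hα2 : ∀ m, α m < 2) (φ : 𝓢(EuclideanSpace ℝ (Fin N), ℂ)) {t : ℝ} (ht : 0 < t) :
    HasDerivAt (fun s => ∫ ξ, (symbolExp a α s ξ : ℂ) * φ ξ)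
      (∫ ξ, (symbolExp a α t ξ : ℂ) *
        ((multitermSymbol a α ((2 * Real.pi) • ξ) : ℂ) * φ ξ)) t := by
  have hB := integrable_multitermSymbol_mul ha hα hα2 φ
  have hS : ∀ s, Continuous fun ξ : EuclideanSpace ℝ (Fin N) => (symbolExp a α s ξ : ℂ) :=
    fun s => Complex.continuous_ofReal.comp (continuous_symbolExp hα s)
  have hle : ∀ s, 0 < s → ∀ ξ : EuclideanSpace ℝ (Fin N), ‖(symbolExp a α s ξ : ℂ)‖ ≤ 1 := by
    intro s hs ξ
    rw [Complex.norm_real, Real.norm_of_nonneg (symbolExp_pos _ _ _ _).le]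
    exact symbolExp_le_one ha hs.le ξ
  refine (hasDerivAt_integral_of_dominated_loc_of_deriv_le (Ioi_mem_nhds ht)
    (Eventually.of_forall fun s => ((hS s).mul φ.continuous).aestronglyMeasurable)
    (φ.integrable.bdd_mul (hS t).aestronglyMeasurable (ae_of_all _ (hle t ht)))
    ((hS t).aestronglyMeasurable.mul hB.aestronglyMeasurable)
    (F' := fun s ξ => (symbolExp a α s ξ : ℂ) *
        ((multitermSymbol a α ((2 * Real.pi) • ξ) : ℂ) * φ ξ))
    (ae_of_all _ fun ξ s hs => ?_) hB.norm (ae_of_all _ fun ξ s _ => ?_)).2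
  · rw [norm_mul]
    exact mul_le_of_le_one_left (norm_nonneg _) (hle s hs ξ)
  · have h : HasDerivAt (fun s => symbolExp a α s ξ)
        (symbolExp a α s ξ * multitermSymbol a α ((2 * Real.pi) • ξ)) s := by
      simpa [symbolExp] using
        ((hasDerivAt_id s).mul_const (multitermSymbol a α ((2 * Real.pi) • ξ))).exp
    have h' := h.ofReal_comp.mul_const (φ ξ)
    rw [Complex.ofReal_mul, mul_assoc] at h'
    exact h'

lemma tendsto_integral_symbolExp_mul (ha : ∀ m, 0 < a m) (hα : ∀ m, 0 < α m)
    (φ : 𝓢(EuclideanSpace ℝ (Fin N), ℂ)) :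
    Tendsto (fun s => ∫ ξ, (symbolExp a α s ξ : ℂ) * φ ξ) (𝓝[>] 0) (𝓝 (∫ ξ, φ ξ)) := by
  refine tendsto_integral_filter_of_dominated_convergence (fun ξ => ‖φ ξ‖)
    (Eventually.of_forall fun s => ((Complex.continuous_ofReal.comp
      (continuous_symbolExp hα s)).mul φ.continuous).aestronglyMeasurable) ?_ φ.integrable.norm
    (ae_of_all _ fun ξ => ?_)
  · filter_upwards [self_mem_nhdsWithin] with s hs
    refine ae_of_all _ fun ξ => ?_
    rw [norm_mul, Complex.norm_real, Real.norm_of_nonneg (symbolExp_pos _ _ _ _).le]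
    exact mul_le_of_le_one_left (norm_nonneg _) (symbolExp_le_one ha (le_of_lt hs) ξ)
  · have : Continuous fun s : ℝ => (symbolExp a α s ξ : ℂ) * φ ξ := by
      unfold symbolExp
      fun_prop
    refine Tendsto.mono_left ?_ nhdsWithin_le_nhds
    simpa [symbolExp] using this.tendsto 0

theorem isFundamentalSolution_fundamentalSolution [NeZero N] [NeZero M] (ha : ∀ m, 0 < a m)
    (hα : ∀ m, 0 < α m) (hα2 : ∀ m, α m < 2) :
    IsFundamentalSolution a α
      (fundamentalSolution a α : ℝ → EuclideanSpace ℝ (Fin N) → ℝ) := by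
  have hpair : ∀ φ : 𝓢(EuclideanSpace ℝ (Fin N), ℂ), ∀ s, 0 < s →
      ∫ x, (fundamentalSolution a α s x : ℂ) * φ x =
        ∫ ξ, (symbolExp a α s ξ : ℂ) * (𝓕 φ) ξ := by
    intro φ s hs
    rw [integral_mul_eq_integral_fourierInv_mul_fourier
      (integrable_complex_ofReal (integrable_fundamentalSolution ha hα hα2 hs)),
      fourierInv_fundamentalSolution ha hα hα2 hs]
  refine ⟨fun t ht => integrable_fundamentalSolution ha hα hα2 ht, fun T hT => ⟨1, ?_⟩, ?_, ?_⟩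
  · intro t ht _
    have h := isProbDensity_fundamentalSolution (N := N) ha hα hα2 ht
    rw [← h.integral_eq_one]
    refine (integral_congr_ae (ae_of_all _ fun x => ?_)).le
    exact Real.norm_of_nonneg (fundamentalSolution_nonneg ha hα hα2 ht x)
  · intro φ t ht
    rw [integral_mul_multitermOp ha hα hα2 (integrable_complex_ofReal (integrable_fundamentalSolution ha hα hα2 ht)),
      fourierInv_fundamentalSolution ha hα hα2 ht]
    refine (hasDerivAt_integral_symbolExp_mul ha hα hα2 (𝓕 φ) ht).congr_of_eventuallyEq ?_
    filter_upwards [Ioi_mem_nhds ht] with s hs using hpair φ s hs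
  · intro φ
    rw [← integral_schwartz_fourier φ]
    refine (tendsto_integral_symbolExp_mul ha hα (𝓕 φ)).congr' ?_
    filter_upwards [self_mem_nhdsWithin] with s hs using (hpair φ s hs).symm

namespace IsFundamentalSolution

variable {u v : ℝ → EuclideanSpace ℝ (Fin N) → ℝ}

lemma integral_mul_fourierInv_schwartz (hu : IsFundamentalSolution a α u)
    (η : 𝓢(EuclideanSpace ℝ (Fin N), ℂ)) {s : ℝ} (hs : 0 < s) :
    ∫ x, (u s x : ℂ) * (𝓕⁻ η) x = ∫ ξ, 𝓕⁻ (fun x => (u s x : ℂ)) ξ * η ξ := by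
  rw [integral_mul_eq_integral_fourierInv_mul_fourier (integrable_complex_ofReal (hu.integrable s hs)),
    FourierTransform.fourier_fourierInv_eq]

lemma hasDerivAt_fourierInv (hu : IsFundamentalSolution a α u) (ha : ∀ m, 0 < a m)
    (hα : ∀ m, 0 < α m) (hα2 : ∀ m, α m < 2) (η : 𝓢(EuclideanSpace ℝ (Fin N), ℂ)) {t : ℝ}
    (ht : 0 < t) :
    HasDerivAt (fun s => ∫ ξ, 𝓕⁻ (fun x => (u s x : ℂ)) ξ * η ξ)
      (∫ ξ, 𝓕⁻ (fun x => (u t x : ℂ)) ξ *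
        ((multitermSymbol a α ((2 * Real.pi) • ξ) : ℂ) * η ξ)) t := by
  have h := hu.weak_eq (𝓕⁻ η) t ht
  rw [integral_mul_multitermOp ha hα hα2 (integrable_complex_ofReal (hu.integrable t ht)),
    FourierTransform.fourier_fourierInv_eq] at h
  refine h.congr_of_eventuallyEq ?_
  filter_upwards [Ioi_mem_nhds ht] with s hs
  exact (hu.integral_mul_fourierInv_schwartz η hs).symm

lemma tendsto_fourierInv (hu : IsFundamentalSolution a α u)
    (η : 𝓢(EuclideanSpace ℝ (Fin N), ℂ)) :
    Tendsto (fun s => ∫ ξ, 𝓕⁻ (fun x => (u s x : ℂ)) ξ * η ξ) (𝓝[>] 0) (𝓝 (∫ ξ, η ξ)) := by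
  have h := hu.initial (𝓕⁻ η)
  rw [← integral_schwartz_fourier, FourierTransform.fourier_fourierInv_eq] at h
  refine h.congr' ?_
  filter_upwards [self_mem_nhdsWithin] with s hs
  exact hu.integral_mul_fourierInv_schwartz η hs

/-- The `L¹` bound on the solution becomes a sup bound on its transform, uniform for times up to
`T`. -/
lemma exists_norm_integral_fourierInv_le (hu : IsFundamentalSolution a α u) {T : ℝ}
    (hT : 0 < T) : ∃ C : ℝ, 0 ≤ C ∧ ∀ t, 0 < t → t ≤ T →
      ∀ g : EuclideanSpace ℝ (Fin N) → ℂ, Integrable g →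
        ‖∫ ξ, 𝓕⁻ (fun x => (u t x : ℂ)) ξ * g ξ‖ ≤ C * ∫ ξ, ‖g ξ‖ := by
  obtain ⟨C, hC⟩ := hu.locally_bounded T hT
  refine ⟨C, (integral_nonneg fun x => norm_nonneg _).trans (hC T hT le_rfl),
    fun t ht htT g hg => ?_⟩
  rw [← integral_const_mul]
  refine norm_integral_le_of_norm_le (hg.norm.const_mul C) (ae_of_all _ fun ξ => ?_)
  rw [norm_mul]
  gcongr
  refine (norm_fourierInv_le _ ξ).trans ?_
  simpa using hC t ht htT

end IsFundamentalSolution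

end

/-! ### Uniqueness of the fundamental solution. -/

/-- A hierarchy `F k' = F (k + 1)` with geometric growth in `k` and zero initial values
vanishes. -/
lemma eq_zero_of_hasDerivAt_succ {E : Type*} [NormedAddCommGroup E] [NormedSpace ℝ E]
    {F : ℕ → ℝ → E} {C K T : ℝ} (hK : 0 ≤ K) (hC : 0 ≤ C)
    (hF : ∀ k s, 0 < s → s ≤ T → HasDerivAt (F k) (F (k + 1) s) s)
    (hb : ∀ k s, 0 < s → s ≤ T → ‖F k s‖ ≤ C * K ^ k)
    (h0 : ∀ k, Tendsto (F k) (𝓝[>] 0) (𝓝 0)) {t : ℝ} (ht : 0 < t) (htT : t ≤ T) (k : ℕ) :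
    F k t = 0 := by
  -- Each integration in time trades a derivative for a factor `r / j`, as in Taylor's remainder;
  -- the factorial then beats `K ^ j`.
  have key : ∀ j k : ℕ, ∀ r, 0 < r → r ≤ T →
      ‖F k r‖ ≤ C * K ^ (k + j) * (r ^ j / j.factorial) := by
    intro j
    induction j with
    | zero => simpa using hb
    | succ j ih =>
      intro k r hr hrT
      -- `F k` has only a limit at `0`, so the mean value inequality is applied on `[s, r]` before
      -- `s → 0`.
      have hstep : ∀ s, 0 < s → s ≤ r → ‖F k r - F k s‖ ≤
          C * K ^ (k + (j + 1)) * (r ^ (j + 1) / (j + 1).factorial) := by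
        intro s hs hsr
        refine image_norm_le_of_norm_deriv_right_le_deriv_boundary
          (f := fun x => F k x - F k s) (f' := fun x => F (k + 1) x) (a := s) (b := r)
          (B := fun x => C * K ^ (k + (j + 1)) * (x ^ (j + 1) / (j + 1).factorial))
          (B' := fun x => C * K ^ (k + 1 + j) * (x ^ j / j.factorial)) ?_ ?_ ?_ ?_ ?_
          ⟨hsr, le_rfl⟩
        · exact fun x hx => ((hF k x (hs.trans_le hx.1)
            (hx.2.trans hrT)).sub_const _).continuousAt.continuousWithinAt
        · exact fun x hx => ((hF k x (hs.trans_le hx.1)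
            (hx.2.le.trans hrT)).sub_const _).hasDerivWithinAt
        · simp only [sub_self, norm_zero]
          positivity
        · intro x
          have h := ((hasDerivAt_pow (j + 1) x).div_const ((j + 1).factorial : ℝ)).const_mul
            (C * K ^ (k + (j + 1)))
          have e : C * K ^ (k + (j + 1)) * (((j + 1 : ℕ) : ℝ) * x ^ (j + 1 - 1) /
              (j + 1).factorial) = C * K ^ (k + 1 + j) * (x ^ j / j.factorial) := by
            rw [Nat.factorial_succ, show k + 1 + j = k + (j + 1) by ring]
            push_cast
            have : (j.factorial : ℝ) ≠ 0 := by positivity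
            field_simp
          rw [e] at h
          exact h
        · exact fun x hx => ih (k + 1) x (hs.trans_le hx.1) (hx.2.le.trans hrT)
      have hlim : Tendsto (fun s => ‖F k r - F k s‖) (𝓝[>] 0) (𝓝 ‖F k r - 0‖) :=
        (tendsto_const_nhds.sub (h0 k)).norm
      rw [sub_zero] at hlim
      refine le_of_tendsto hlim ?_
      filter_upwards [Ioc_mem_nhdsGT hr] with s hs using hstep s hs.1 hs.2
  have hlim : Tendsto (fun j : ℕ => C * K ^ k * ((K * t) ^ j / j.factorial)) atTop (𝓝 0) := by
    simpa using (FloorSemiring.tendsto_pow_div_factorial_atTop (K * t)).const_mul (C * K ^ k)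
  refine norm_le_zero_iff.1 (ge_of_tendsto' hlim fun j => ?_)
  refine (key j k t ht htT).trans_eq ?_
  rw [pow_add, mul_pow]
  ring

section

variable {N M : ℕ} {a α : Fin M → ℝ}

lemma contDiffAt_multitermSymbol_smul {ξ : EuclideanSpace ℝ (Fin N)} (hξ : ξ ≠ 0) :
    ContDiffAt ℝ (⊤ : ℕ∞) (fun ξ : EuclideanSpace ℝ (Fin N) =>
      multitermSymbol a α ((2 * Real.pi) • ξ)) ξ := by
  simp_rw [multitermSymbol_smul]
  refine (ContDiffAt.sum fun m _ => contDiffAt_const.mul ?_).neg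
  exact (contDiffAt_norm ℝ hξ).rpow_const_of_ne (norm_ne_zero_iff.2 hξ)

/-- The product of a test function supported away from the origin with a power of the symbol is
again a test function. -/
lemma exists_schwartz_symbol_pow_mul {g : EuclideanSpace ℝ (Fin N) → ℝ}
    (hg : ContDiff ℝ (⊤ : ℕ∞) g) (hc : HasCompactSupport g) (h0 : tsupport g ⊆ {0}ᶜ) (k : ℕ) :
    ∃ η : 𝓢(EuclideanSpace ℝ (Fin N), ℂ),
      ∀ ξ, η ξ = (multitermSymbol a α ((2 * Real.pi) • ξ) : ℂ) ^ k * (g ξ : ℂ) := by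
  let f : EuclideanSpace ℝ (Fin N) → ℝ :=
    fun ξ => multitermSymbol a α ((2 * Real.pi) • ξ) ^ k * g ξ
  have hf : ContDiff ℝ (⊤ : ℕ∞) f := by
    refine contDiff_iff_contDiffAt.2 fun ξ => ?_
    by_cases hξ : ξ ∈ tsupport g
    · exact ((contDiffAt_multitermSymbol_smul (h0 hξ)).pow k).mul hg.contDiffAt
    · refine (contDiffAt_const (c := (0 : ℝ))).congr_of_eventuallyEq ?_
      filter_upwards [notMem_tsupport_iff_eventuallyEq.1 hξ] with x hx
      simp [f, hx]
  have hfc : HasCompactSupport f := hc.mul_left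
  have hfC : HasCompactSupport (fun ξ => (f ξ : ℂ)) :=
    hfc.comp_left (g := ((↑) : ℝ → ℂ)) Complex.ofReal_zero
  refine ⟨hfC.toSchwartzMap (Complex.ofRealCLM.contDiff.comp hf), fun ξ => ?_⟩
  simp [f]

lemma exists_abs_multitermSymbol_le (hα : ∀ m, 0 < α m) {g : EuclideanSpace ℝ (Fin N) → ℝ}
    (hc : HasCompactSupport g) :
    ∃ K : ℝ, 0 ≤ K ∧ ∀ ξ, g ξ ≠ 0 → ‖multitermSymbol a α ((2 * Real.pi) • ξ)‖ ≤ K := by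
  obtain ⟨K, hK⟩ := hc.isCompact.exists_bound_of_continuousOn
    (continuous_multitermSymbol_smul (N := N) (a := a) hα).continuousOn
  exact ⟨max K 0, le_max_right _ _, fun ξ hξ =>
    (hK ξ (subset_tsupport g hξ)).trans (le_max_left _ _)⟩

namespace IsFundamentalSolution

variable {u v : ℝ → EuclideanSpace ℝ (Fin N) → ℝ}

/-- The hierarchy consists of the pairings of the difference of the transforms with `B ^ k g`; on
the compact support of `g` the symbol is bounded by some `K`, which gives the geometric growth. -/
lemma integral_fourierInv_eq (hu : IsFundamentalSolution a α u)
    (hv : IsFundamentalSolution a α v) (ha : ∀ m, 0 < a m)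
    (hα : ∀ m, 0 < α m) (hα2 : ∀ m, α m < 2) {g : EuclideanSpace ℝ (Fin N) → ℝ}
    (hg : ContDiff ℝ (⊤ : ℕ∞) g) (hc : HasCompactSupport g) (h0 : tsupport g ⊆ {0}ᶜ)
    {t : ℝ} (ht : 0 < t) :
    ∫ ξ, 𝓕⁻ (fun x => (u t x : ℂ)) ξ * g ξ = ∫ ξ, 𝓕⁻ (fun x => (v t x : ℂ)) ξ * g ξ := by
  choose η hη using fun k => exists_schwartz_symbol_pow_mul (a := a) (α := α) hg hc h0 k
  obtain ⟨K, hK0, hK⟩ := exists_abs_multitermSymbol_le (a := a) hα hc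
  obtain ⟨C, hC0, hC⟩ := hu.exists_norm_integral_fourierInv_le ht
  obtain ⟨D, hD0, hD⟩ := hv.exists_norm_integral_fourierInv_le ht
  have hsucc : ∀ k, ∀ ξ, (multitermSymbol a α ((2 * Real.pi) • ξ) : ℂ) * η k ξ =
      η (k + 1) ξ := by
    intro k ξ
    rw [hη, hη, pow_succ]
    ring
  have hηK : ∀ k, ∫ ξ, ‖η k ξ‖ ≤ K ^ k * ∫ ξ, ‖η 0 ξ‖ := by
    intro k
    rw [← integral_const_mul]
    refine integral_mono (η k).integrable.norm ((η 0).integrable.norm.const_mul _) fun ξ => ?_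
    simp only [hη, pow_zero, one_mul, norm_mul, norm_pow, Complex.norm_real]
    rcases eq_or_ne (g ξ) 0 with h | h
    · simp [h]
    · gcongr
      exact hK ξ h
  have h := eq_zero_of_hasDerivAt_succ (T := t) hK0
    (C := (C + D) * ∫ ξ, ‖η 0 ξ‖)
    (F := fun k s => (∫ ξ, 𝓕⁻ (fun x => (u s x : ℂ)) ξ * η k ξ) -
      ∫ ξ, 𝓕⁻ (fun x => (v s x : ℂ)) ξ * η k ξ)
    (mul_nonneg (by positivity) (integral_nonneg fun _ => norm_nonneg _))
    (fun k s hs _ => by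
      have h1 := hu.hasDerivAt_fourierInv ha hα hα2 (η k) hs
      have h2 := hv.hasDerivAt_fourierInv ha hα hα2 (η k) hs
      simp_rw [hsucc] at h1 h2
      exact h1.sub h2)
    (fun k s hs hst => by
      refine (norm_sub_le _ _).trans ?_
      have h1 := hC s hs hst (η k) (η k).integrable
      have h2 := hD s hs hst (η k) (η k).integrable
      calc _ ≤ C * (∫ ξ, ‖η k ξ‖) + D * ∫ ξ, ‖η k ξ‖ := add_le_add h1 h2
        _ = (C + D) * ∫ ξ, ‖η k ξ‖ := by ring
        _ ≤ (C + D) * (K ^ k * ∫ ξ, ‖η 0 ξ‖) := by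
            gcongr
            exact hηK k
        _ = _ := by ring)
    (fun k => by simpa using (hu.tendsto_fourierInv (η k)).sub (hv.tendsto_fourierInv (η k)))
    ht le_rfl 0
  simp only [hη, pow_zero, one_mul] at h
  exact sub_eq_zero.1 h

theorem ae_eq [NeZero N] (hu : IsFundamentalSolution a α u) (hv : IsFundamentalSolution a α v)
    (ha : ∀ m, 0 < a m) (hα : ∀ m, 0 < α m) (hα2 : ∀ m, α m < 2) {t : ℝ} (ht : 0 < t) :
    u t =ᵐ[volume] v t := by
  have hui := integrable_complex_ofReal (hu.integrable t ht)
  have hvi := integrable_complex_ofReal (hv.integrable t ht)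
  have huc := continuous_fourierInv hui
  have hvc := continuous_fourierInv hvi
  -- Test functions supported off the origin suffice because `{0}` is a null set for `N ≥ 1`.
  have hfourier : ∀ᵐ ξ, 𝓕⁻ (fun x => (u t x : ℂ)) ξ = 𝓕⁻ (fun x => (v t x : ℂ)) ξ := by
    have h := (isOpen_compl_singleton (x := (0 : EuclideanSpace ℝ (Fin N)))
      ).ae_eq_zero_of_integral_contDiff_smul_eq_zero (μ := volume)
      (f := fun ξ => 𝓕⁻ (fun x => (u t x : ℂ)) ξ - 𝓕⁻ (fun x => (v t x : ℂ)) ξ)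
      ((huc.sub hvc).locallyIntegrable.locallyIntegrableOn _)
      (fun g hg hc h0 => by
        have hgC : Continuous fun ξ => (g ξ : ℂ) := Complex.continuous_ofReal.comp hg.continuous
        have hgs : HasCompactSupport fun ξ => (g ξ : ℂ) :=
          hc.comp_left (g := ((↑) : ℝ → ℂ)) Complex.ofReal_zero
        have h1 := (huc.mul hgC).integrable_of_hasCompactSupport (μ := volume) hgs.mul_left
        have h2 := (hvc.mul hgC).integrable_of_hasCompactSupport (μ := volume) hgs.mul_left
        have h3 : ∀ ξ, g ξ • (𝓕⁻ (fun x => (u t x : ℂ)) ξ - 𝓕⁻ (fun x => (v t x : ℂ)) ξ) =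
            𝓕⁻ (fun x => (u t x : ℂ)) ξ * g ξ - 𝓕⁻ (fun x => (v t x : ℂ)) ξ * g ξ := by
          intro ξ
          rw [Complex.real_smul]
          ring
        simp_rw [h3]
        refine (integral_sub h1 h2).trans ?_
        simp only [Pi.mul_apply]
        rw [hu.integral_fourierInv_eq hv ha hα hα2 hg hc h0 ht, sub_self])
    filter_upwards [h, Measure.ae_ne volume (0 : EuclideanSpace ℝ (Fin N))] with ξ h1 h2
    exact sub_eq_zero.1 (h1 h2)
  have h := ae_eq_zero_of_integral_contDiff_smul_eq_zero (μ := volume)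
    (f := fun x => u t x - v t x)
    ((hu.integrable t ht).sub (hv.integrable t ht)).locallyIntegrable (fun g hg hc => by
      let φ : 𝓢(EuclideanSpace ℝ (Fin N), ℂ) :=
        HasCompactSupport.toSchwartzMap (f := fun x => (g x : ℂ))
          (hc.comp_left (g := ((↑) : ℝ → ℂ)) Complex.ofReal_zero)
          (Complex.ofRealCLM.contDiff.comp hg)
      have h1 := integral_mul_eq_integral_fourierInv_mul_fourier hui φ
      have h2 := integral_mul_eq_integral_fourierInv_mul_fourier hvi φ
      have h3 : ∫ x, (u t x : ℂ) * φ x = ∫ x, (v t x : ℂ) * φ x := by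
        rw [h1, h2]
        refine integral_congr_ae ?_
        filter_upwards [hfourier] with ξ hξ
        rw [hξ]
      have h4 : ∀ x, φ x = (g x : ℂ) := fun x => rfl
      simp_rw [h4, ← Complex.ofReal_mul] at h3
      rw [integral_complex_ofReal, integral_complex_ofReal, Complex.ofReal_inj] at h3
      obtain ⟨C, hC⟩ := hc.exists_bound_of_continuous hg.continuous
      have h5 := (hu.integrable t ht).mul_bdd (c := C) hg.continuous.aestronglyMeasurable
        (ae_of_all _ hC)
      have h6 := (hv.integrable t ht).mul_bdd (c := C) hg.continuous.aestronglyMeasurable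
        (ae_of_all _ hC)
      simp_rw [smul_eq_mul, mul_comm (g _), sub_mul]
      rw [integral_sub h5 h6, h3, sub_self])
  filter_upwards [h] with x hx
  exact sub_eq_zero.1 hx

end IsFundamentalSolution

end

/-! ### Characteristic functions of the random walk. -/

section

variable {N M : ℕ} {a α : Fin M → ℝ}

lemma jumpWeight_neg (a α : Fin M → ℝ) (τ h : ℝ) (k : Fin N → ℤ) :
    jumpWeight a α τ h (-k) = jumpWeight a α τ h k := by
  simp [jumpWeight, latticePoint_neg]

lemma transitionProb_neg (a α : Fin M → ℝ) (τ h : ℝ) (k : Fin N → ℤ) :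
    transitionProb a α τ h (-k) = transitionProb a α τ h k := by
  simp [transitionProb, jumpWeight_neg]

/-- The factor `1 - cos` removes `p_0`. For `k ≠ 0`, `2τ h ^ (-α) / |k| ^ (N + α) = 2τ h ^ N / |h k|
^ (N + α)`, so `h ^ N` is the cell volume of a Riemann sum. -/
lemma transitionProb_mul_one_sub_cos (τ : ℝ) {h : ℝ} (hh : 0 < h) (k : Fin N → ℤ)
    (ξ : EuclideanSpace ℝ (Fin N)) :
    transitionProb a α τ h k * (1 - Real.cos (inner ℝ (h • latticePoint k) ξ)) =
      ∑ m, τ * (a m * (2 * normConst N (α m))) *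
        (h ^ N * levyKernel (α m) ξ (h • latticePoint k)) := by
  rcases eq_or_ne k 0 with rfl | hk
  · simp [levyKernel]
  have hL : 0 < ‖latticePoint k‖ := norm_pos_iff.2 (latticePoint_ne_zero hk)
  rw [transitionProb, if_neg hk, jumpWeight, Finset.mul_sum, Finset.sum_mul]
  refine Finset.sum_congr rfl fun m _ => ?_
  rw [levyKernel, norm_smul, Real.norm_of_nonneg hh.le, Real.mul_rpow hh.le hL.le,
    Real.rpow_add hh, Real.rpow_add hL, Real.rpow_natCast, Real.rpow_natCast, scaleFactor]
  have h1 : h ^ α m ≠ 0 := by positivity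
  have h2 : ‖latticePoint k‖ ^ α m ≠ 0 := by positivity
  field_simp

/-- The characteristic function of a symmetric random vector with values in `h ℤ^N`. -/
lemma charFun_map_smul_latticePoint {Ω : Type*} [MeasurableSpace Ω] {P : Measure Ω}
    [IsProbabilityMeasure P] {Y : Ω → Fin N → ℤ} (hY : Measurable Y) (h : ℝ)
    {p : (Fin N → ℤ) → ℝ} (hp : ∀ k, P.real {ω | Y ω = k} = p k) (hsymm : ∀ k, p (-k) = p k)
    (ξ : EuclideanSpace ℝ (Fin N)) :
    charFun (P.map fun ω => h • latticePoint (Y ω)) ξ =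
      ((1 - ∑' k, p k * (1 - Real.cos (inner ℝ (h • latticePoint k) ξ)) : ℝ) : ℂ) := by
  set μ := P.map Y with hμ
  have hprob : IsProbabilityMeasure μ := Measure.isProbabilityMeasure_map hY.aemeasurable
  have hpμ : ∀ k, μ.real {k} = p k := by
    intro k
    rw [← hp, hμ, map_measureReal_apply hY (measurableSet_singleton k)]
    rfl
  have hneg : μ.map (fun k => -k) = μ := by
    refine Measure.ext_of_singleton fun k => ?_
    have hm : Measurable fun k : Fin N → ℤ => -k := measurable_of_countable _
    have : (fun k : Fin N → ℤ => -k) ⁻¹' {k} = {-k} := by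
      ext j
      simp
    rw [Measure.map_apply hm (measurableSet_singleton k), this,
      ← measureReal_eq_measureReal_iff, hpμ, hpμ, hsymm]
  let θ : (Fin N → ℤ) → ℝ := fun k => inner ℝ (h • latticePoint k) ξ
  have hθ : ∀ k, θ (-k) = -θ k := fun k => by simp [θ, latticePoint_neg]
  have h1 : charFun (P.map fun ω => h • latticePoint (Y ω)) ξ =
      ∫ k, Complex.exp (θ k * Complex.I) ∂μ := by
    have hm : Measurable fun k : Fin N → ℤ => h • latticePoint k := measurable_of_countable _
    have hmY : Measurable fun ω => h • latticePoint (Y ω) := hm.comp hY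
    rw [charFun_apply, integral_map hmY.aemeasurable
      (Continuous.aestronglyMeasurable (by fun_prop)), hμ, integral_map hY.aemeasurable
      (measurable_of_countable _).aestronglyMeasurable]
  -- The law is invariant under `k ↦ -k`, so the characteristic function is the integral of the
  -- cosine alone.
  have h2 : ∫ k, Complex.exp (θ k * Complex.I) ∂μ =
      ∫ k, Complex.exp (-(θ k * Complex.I)) ∂μ := by
    conv_lhs => rw [← hneg]
    rw [integral_map (measurable_of_countable _).aemeasurable
      (measurable_of_countable _).aestronglyMeasurable]
    simp only [hθ, Complex.ofReal_neg, neg_mul]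
  have hi1 : Integrable (fun k => Complex.exp (θ k * Complex.I)) μ :=
    Integrable.of_bound (measurable_of_countable _).aestronglyMeasurable 1
      (ae_of_all _ fun k => (Complex.norm_exp_ofReal_mul_I _).le)
  have hi2 : Integrable (fun k => Complex.exp (-(θ k * Complex.I))) μ :=
    Integrable.of_bound (measurable_of_countable _).aestronglyMeasurable 1
      (ae_of_all _ fun k => by
        rw [← neg_mul, ← Complex.ofReal_neg]
        exact (Complex.norm_exp_ofReal_mul_I _).le)
  have hi3 : Integrable (fun k => Real.cos (θ k)) μ :=
    Integrable.of_bound (measurable_of_countable _).aestronglyMeasurable 1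
      (ae_of_all _ fun k => Real.abs_cos_le_one _)
  have h3 : ∫ k, Complex.exp (θ k * Complex.I) ∂μ = ((∫ k, Real.cos (θ k) ∂μ : ℝ) : ℂ) := by
    have h4 : ∫ k, (Complex.exp (θ k * Complex.I) + Complex.exp (-(θ k * Complex.I))) ∂μ =
        ∫ k, 2 * ((Real.cos (θ k) : ℝ) : ℂ) ∂μ := by
      refine integral_congr_ae (ae_of_all _ fun k => ?_)
      simp only
      rw [Complex.ofReal_cos, Complex.two_cos, neg_mul]
    rw [integral_add hi1 hi2, ← h2, integral_const_mul, integral_complex_ofReal, ← two_mul] at h4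
    exact mul_left_cancel₀ two_ne_zero h4
  rw [h1, h3, Complex.ofReal_inj]
  have h5 := integral_countable (μ := μ) ((integrable_const (1 : ℝ)).sub hi3)
  simp only [hpμ, smul_eq_mul, Pi.sub_apply] at h5
  rw [← h5, integral_sub (integrable_const _) hi3]
  simp

lemma charFun_map_jump [NeZero N] (hα : ∀ m, 0 < α m) (hα2 : ∀ m, α m < 2) {Ω : Type*}
    [MeasurableSpace Ω] {P : Measure Ω} [IsProbabilityMeasure P] {Y : Ω → Fin N → ℤ}
    (hY : Measurable Y) {h τ : ℝ} (hh : 0 < h)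
    (hp : ∀ k, P.real {ω | Y ω = k} = transitionProb a α τ h k)
    (ξ : EuclideanSpace ℝ (Fin N)) :
    charFun (P.map fun ω => h • latticePoint (Y ω)) ξ =
      1 + ((-(τ * ∑ m, a m * (2 * normConst N (α m)) *
        (h ^ N * ∑' k : Fin N → ℤ, levyKernel (α m) ξ (h • latticePoint k))) : ℝ) : ℂ) := by
  rw [charFun_map_smul_latticePoint hY h hp (transitionProb_neg a α τ h)]
  simp_rw [transitionProb_mul_one_sub_cos τ hh]
  rw [Summable.tsum_finsetSum (s := Finset.univ) fun m _ =>
    ((summable_levyKernel hh (hα m) (hα2 m) ξ).mul_left _).mul_left _]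
  simp_rw [tsum_mul_left]
  rw [Finset.mul_sum, sub_eq_add_neg, Complex.ofReal_add, Complex.ofReal_one]
  refine congrArg (fun r : ℝ => (1 + ((-r : ℝ) : ℂ))) (Finset.sum_congr rfl fun m _ => ?_)
  ring

lemma charFun_map_scaledSum [NeZero N] (hα : ∀ m, 0 < α m) (hα2 : ∀ m, α m < 2) {Ω : Type*}
    [MeasurableSpace Ω] {P : Measure Ω} [IsProbabilityMeasure P] {X : ℕ → Ω → Fin N → ℤ}
    (hX : ∀ i, Measurable (X i)) (hind : iIndepFun X P) {h τ : ℝ} (hh : 0 < h)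
    (hp : ∀ i k, P.real {ω | X i ω = k} = transitionProb a α τ h k) (n : ℕ)
    (ξ : EuclideanSpace ℝ (Fin N)) :
    charFun (P.map (scaledSum h X n)) ξ =
      (1 + ((-(τ * ∑ m, a m * (2 * normConst N (α m)) *
        (h ^ N * ∑' k : Fin N → ℤ, levyKernel (α m) ξ (h • latticePoint k))) : ℝ) : ℂ)) ^ n := by
  have hm : Measurable fun k : Fin N → ℤ => h • latticePoint k := measurable_of_countable _
  have hmX : ∀ i, Measurable fun ω => h • latticePoint (X i ω) := fun i => hm.comp (hX i)
  have hind' : iIndepFun (fun i ω => h • latticePoint (X i ω)) P :=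
    hind.comp (fun _ k => h • latticePoint k) fun _ => hm
  have hs := iIndepFun.charFun_map_fun_finsetSum_eq_prod (s := Finset.range n)
    (fun i _ => (hmX i).aemeasurable) (hind'.restrict _)
  have hs' := congrFun hs ξ
  rw [Finset.prod_apply, Finset.prod_congr rfl
    (fun i _ => charFun_map_jump hα hα2 (hX i) hh (hp i) ξ), Finset.prod_const,
    Finset.card_range] at hs'
  exact hs'

/-- The inverse Fourier transform is evaluated at `ξ / (2π)`, which converts its normalisation to
that of `charFun`. -/
lemma charFun_withDensity_fundamentalSolution [NeZero N] [NeZero M] (ha : ∀ m, 0 < a m)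
    (hα : ∀ m, 0 < α m) (hα2 : ∀ m, α m < 2) {t : ℝ} (ht : 0 < t)
    (ξ : EuclideanSpace ℝ (Fin N)) :
    charFun (volume.withDensity fun x => ENNReal.ofReal (fundamentalSolution a α t x)) ξ =
      Complex.exp ((t * multitermSymbol a α ξ : ℝ) : ℂ) := by
  have h := congrFun (fourierInv_fundamentalSolution (N := N) ha hα hα2 ht)
    ((2 * Real.pi)⁻¹ • ξ)
  have hpi : 2 * Real.pi ≠ 0 := by positivity
  rw [symbolExp, smul_inv_smul₀ hpi, Complex.ofReal_exp, Real.fourierInv_eq'] at h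
  rw [← h, charFun_apply, integral_withDensity_eq_integral_toReal_smul
    (continuous_fundamentalSolution ha hα ht).measurable.ennreal_ofReal
    (ae_of_all _ fun x => ENNReal.ofReal_lt_top)]
  refine integral_congr_ae (ae_of_all _ fun x => ?_)
  simp only
  rw [ENNReal.toReal_ofReal (fundamentalSolution_nonneg ha hα hα2 ht x), inner_smul_right,
    mul_inv_cancel_left₀ hpi, Complex.real_smul, smul_eq_mul, mul_comm]

/-- As `τ = t / n`, the characteristic function is `(1 + z_n / n) ^ n`, where `z_n` is `-t` times a
combination of Riemann sums and tends to `t B(ξ)`. -/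
lemma tendsto_charFun_scaledSum [NeZero N] (hα : ∀ m, 0 < α m) (hα2 : ∀ m, α m < 2) (t : ℝ)
    {h : ℕ → ℝ} (hpos : ∀ n, 1 ≤ n → 0 < h n) (hlim : Tendsto h atTop (𝓝 0))
    {Ω : ℕ → Type*} [∀ n, MeasurableSpace (Ω n)] {P : ∀ n, Measure (Ω n)}
    [∀ n, IsProbabilityMeasure (P n)] {X : ∀ n, ℕ → Ω n → Fin N → ℤ}
    (hX : ∀ n i, Measurable (X n i)) (hind : ∀ n, 1 ≤ n → iIndepFun (X n) (P n))
    (hp : ∀ n, 1 ≤ n → ∀ i (k : Fin N → ℤ),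
      (P n).real {ω | X n i ω = k} = transitionProb a α (t / n) (h n) k)
    (ξ : EuclideanSpace ℝ (Fin N)) :
    Tendsto (fun n => charFun ((P n).map (scaledSum (h n) (X n) n)) ξ) atTop
      (𝓝 (Complex.exp ((t * multitermSymbol a α ξ : ℝ) : ℂ))) := by
  have hh : Tendsto h atTop (𝓝[>] 0) :=
    tendsto_nhdsWithin_iff.2 ⟨hlim, by
      filter_upwards [eventually_ge_atTop 1] with n hn using hpos n hn⟩
  have hsum : Tendsto (fun n => -(t * ∑ m, a m * (2 * normConst N (α m)) *
      (h n ^ N * ∑' k : Fin N → ℤ, levyKernel (α m) ξ (h n • latticePoint k)))) atTop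
      (𝓝 (t * multitermSymbol a α ξ)) := by
    have h1 : t * multitermSymbol a α ξ =
        -(t * ∑ m, a m * (2 * normConst N (α m)) * ∫ y, levyKernel (α m) ξ y) := by
      simp_rw [multitermSymbol, mul_neg, mul_assoc (a _),
        normConst_mul_integral_levyKernel (hα _) (hα2 _)]
    rw [h1]
    exact ((tendsto_finsetSum _ fun m _ =>
      ((tendsto_riemannSum_levyKernel (hα m) (hα2 m) ξ).comp hh).const_mul _).const_mul t).neg
  have hpow := Complex.tendsto_one_add_pow_exp_of_tendsto
    (g := fun n : ℕ => ((-(t / n * ∑ m, a m * (2 * normConst N (α m)) *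
      (h n ^ N * ∑' k : Fin N → ℤ, levyKernel (α m) ξ (h n • latticePoint k))) : ℝ) : ℂ))
    (t := ((t * multitermSymbol a α ξ : ℝ) : ℂ)) (by
      refine ((Complex.continuous_ofReal.tendsto _).comp hsum).congr' ?_
      filter_upwards [eventually_ge_atTop 1] with n hn
      have hn' : (n : ℝ) ≠ 0 := by
        rw [Nat.cast_ne_zero]
        exact Nat.one_le_iff_ne_zero.1 hn
      rw [Function.comp_apply, ← Complex.ofReal_natCast, ← Complex.ofReal_mul, mul_neg,
        ← mul_assoc, mul_div_cancel₀ _ hn'])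
  refine hpow.congr' ?_
  filter_upwards [eventually_ge_atTop 1] with n hn
  exact (charFun_map_scaledSum hα hα2 (hX n) (hind n hn) (hpos n hn) (hp n hn) n ξ).symm

lemma measurable_scaledSum {Ω : Type*} [MeasurableSpace Ω] {X : ℕ → Ω → Fin N → ℤ}
    (hX : ∀ i, Measurable (X i)) (h : ℝ) (n : ℕ) : Measurable (scaledSum h X n) := by
  have hm : Measurable fun k : Fin N → ℤ => h • latticePoint k := measurable_of_countable _
  exact Finset.measurable_sum _ fun i _ => hm.comp (hX i)

end

end FractionalWalk

end

/-! ### The main theorem. -/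

theorem theorem3p2 {N M : ℕ} (hN : 1 ≤ N) (hM : 1 ≤ M) (a α : Fin M → ℝ)
    (ha : ∀ m, 0 < a m) (hα : StrictMono α) (hα_pos : ∀ m, 0 < α m) (hα_lt : ∀ m, α m < 2) :
    ∃ G : ℝ → EuclideanSpace ℝ (Fin N) → ℝ,
      FractionalWalk.IsFundamentalSolution a α G ∧
      (∀ G' : ℝ → EuclideanSpace ℝ (Fin N) → ℝ, FractionalWalk.IsFundamentalSolution a α G' →
        ∀ t, 0 < t → G' t =ᵐ[volume] G t) ∧
      ∀ t, 0 < t →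
        FractionalWalk.IsProbDensity (G t) ∧
        ∀ h : ℕ → ℝ, (∀ n, 1 ≤ n → 0 < h n) → Tendsto h atTop (𝓝 0) →
          (∀ n : ℕ, 1 ≤ n → ∑ m, a m * FractionalWalk.normConst N (α m) *
            FractionalWalk.latticeZeta N (α m) *
              FractionalWalk.scaleFactor (t / n) (h n) (α m) ≤ 1) →
          ∀ {Ω : ℕ → Type*} [∀ n, MeasurableSpace (Ω n)] (P : ∀ n, Measure (Ω n))
            [∀ n, IsProbabilityMeasure (P n)] (X : ∀ n, ℕ → Ω n → Fin N → ℤ),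
            (∀ n i, Measurable (X n i)) →
            (∀ n, 1 ≤ n → iIndepFun (X n) (P n)) →
            (∀ n, 1 ≤ n → ∀ i (k : Fin N → ℤ),
              (P n).real {ω | X n i ω = k} =
                FractionalWalk.transitionProb a α (t / n) (h n) k) →
            ∀ {Ω' : Type*} [MeasurableSpace Ω'] (Q : Measure Ω') [IsProbabilityMeasure Q]
              (Z : Ω' → EuclideanSpace ℝ (Fin N)),
              HasLaw Z (volume.withDensity (fun x => ENNReal.ofReal (G t x))) Q →
              TendstoInDistribution
                (fun n => FractionalWalk.scaledSum (h n) (X n) n) atTop Z P Q := by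
  have : NeZero N := ⟨Nat.one_le_iff_ne_zero.1 hN⟩
  have : NeZero M := ⟨Nat.one_le_iff_ne_zero.1 hM⟩
  refine ⟨FractionalWalk.fundamentalSolution a α,
    FractionalWalk.isFundamentalSolution_fundamentalSolution ha hα_pos hα_lt,
    fun G' hG' t ht => hG'.ae_eq
      (FractionalWalk.isFundamentalSolution_fundamentalSolution ha hα_pos hα_lt)
      ha hα_pos hα_lt ht,
    fun t ht => ⟨FractionalWalk.isProbDensity_fundamentalSolution ha hα_pos hα_lt ht, ?_⟩⟩
  intro h hpos hlim _ Ω _ P _ X hX hind hp Ω' _ Q _ Z hZ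
  -- Lévy's continuity theorem reduces convergence in law to pointwise convergence of characteristic
  -- functions.
  refine ⟨fun n => (FractionalWalk.measurable_scaledSum (hX n) (h n) n).aemeasurable,
    hZ.aemeasurable, ProbabilityMeasure.tendsto_iff_tendsto_charFun.2 fun ξ => ?_⟩
  simp only [ProbabilityMeasure.coe_mk, hZ.map_eq]
  rw [FractionalWalk.charFun_withDensity_fundamentalSolution ha hα_pos hα_lt ht]
  exact FractionalWalk.tendsto_charFun_scaledSum hα_pos hα_lt t hpos hlim hX hind hp ξ
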